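/- Let $G$ be a countable group and $\mu$ a probability measure on $G$ with finite entropy $H(\mu)=-\sum_g\mu(g)\log\mu(g)<\infty$. For a measure $\theta$ on $G$ let $\mathbf P_\theta$ be the law on the path space $G^{\mathbb Z_+}$ of $x_n=x_0h_1\cdots h_n$, where $x_0$ has distribution $\theta$ and the increments $h_i$ are independent, $\mu$-distributed and independent of $x_0$. Put $\mathbf P=\mathbf P_{\delta_e}$ and $\mathbf P_m=\mathbf P_\theta$ for $\theta=m$ the counting measure. Let $T$ be the time shift $(x_n)\mapsto(x_{n+1})$. The Poisson boundary of $(G,\mu)$ is the space of ergodic components of $T$ in $(G^{\mathbb Z_+},\mathbf P_m)$: a standard Borel $G$-space $\Gamma$ with a measurable map $\mathrm{bnd}:G^{\mathbb Z_+}\to\Gamma$ that is $\mathbf P_m$-a.e. $G$-equivariant and such that the $\sigma$-algebra of $T$-invariant measurable sets coincides, mod $\mathbf P_m$, with the $\sigma$-algebra of $\mathrm{bnd}$-preimages of measurable subsets of $\Gamma$. It carries the harmonic measure $\nu=\mathrm{bnd}(\mathbf P)$. A $\mu$-boundary is a quotient of $(\Gamma,\nu)$ by a $G$-invariant measurable partition,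 i.e. a standard Borel $G$-space $B$ with a measurable map $q:\Gamma\to B$ satisfying $q(g\gamma)=g\,q(\gamma)$ for every $g\in G$ and $\nu$-a.e. $\gamma$, endowed with the measure $\lambda=q(\nu)$. Put $\Pi=q\circ\mathrm{bnd}$. We say that $(B,\lambda)$ is the Poisson boundary if $q$ is an isomorphism mod $0$ of $(\Gamma,\nu)$ onto $(B,\lambda)$. A gauge on $G$ is an increasing sequence $\mathcal G=(\mathcal G_k)_{k\ge1}$ of subsets exhausting $G$; put $|g|_{\mathcal G}=\min\{k:g\in\mathcal G_k\}$. A family of gauges $\mathcal G^\alpha$ is uniformly temperate if all sets $\mathcal G^\alpha_k$ are finite and $\sup_{\alpha,k}\frac1k\log\operatorname{card}\mathcal G^\alpha_k<\infty$; a single gauge is temperate if the family consisting of it alone is uniformly temperate. Let $(B,\lambda)$ be a $\mu$-boundary. (1) If to $\lambda$-a.e. $b\in B$ one can assign a sequence of uniformly temperate gauges $\mathcal G^n(b)$ such that $\frac1n|x_n|_{\mathcal G^n(\Pi\mathbf x)}\to0$ for $\mathbf P$-a.e. sample path $\mathbf x=(x_n)$, then $(B,\lambda)$ is the Poisson boundary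 of $(G,\mu)$. (2) If there are a temperate gauge $\mathcal G$ and a sequence of measurable maps $\pi_n:B\to G$ such that $\frac1n\bigl|\pi_n(\Pi\mathbf x)^{-1}x_n\bigr|_{\mathcal G}\to0$ for $\mathbf P$-a.e. sample path $\mathbf x=(x_n)$, then $(B,\lambda)$ is the Poisson boundary of $(G,\mu)$. -/

import Mathlib

open MeasureTheory Filter Topology

noncomputable section

namespace RandomWalk

section Gauges

/-- A gauge on `G`: an increasing sequence of subsets `𝒢_k`, `k ≥ 1`, exhausting `G`. -/
structure Gauge (G : Type*) where
  sets : ℕ+ → Set G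
  mono : Monotone sets
  exhausts : ∀ g : G, ∃ k : ℕ+, g ∈ sets k

/-- The gauge function `|g| = min {k ≥ 1 : g ∈ 𝒢_k}`. -/
def Gauge.norm {G : Type*} (𝒢 : Gauge G) (g : G) : ℕ :=
  sInf {k : ℕ | ∃ h : 0 < k, g ∈ 𝒢.sets ⟨k, h⟩}

/-- A family of gauges is uniformly temperate if all gauge sets are finite and
`sup_{α, k} (1 / k) log card 𝒢^α_k < ∞`. -/
def UniformlyTemperate {G ι : Type*} (𝒢 : ι → Gauge G) : Prop :=
  (∀ (a : ι) (k : ℕ+), ((𝒢 a).sets k).Finite) ∧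
    ∃ C : ℝ, ∀ (a : ι) (k : ℕ+), 1 / (k : ℝ) * Real.log (((𝒢 a).sets k).ncard : ℝ) ≤ C

/-- A gauge is temperate if all gauge sets are finite and `sup_k (1 / k) log card 𝒢_k < ∞`. -/
def Gauge.Temperate {G : Type*} (𝒢 : Gauge G) : Prop :=
  (∀ k : ℕ+, (𝒢.sets k).Finite) ∧
    ∃ C : ℝ, ∀ k : ℕ+, 1 / (k : ℝ) * Real.log ((𝒢.sets k).ncard : ℝ) ≤ C

end Gauges

section PathSpace

variable {G : Type*} [Group G] [MeasurableSpace G]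

/-- Finiteness of the entropy `H(μ) = -∑_g μ(g) log μ(g)`. -/
def FiniteEntropy (μ : Measure G) : Prop :=
  Summable fun g : G => Real.negMulLog (μ.real {g})

/-- The sample path `x_n = x_0 h_1 h_2 ⋯ h_n` with starting point `p.1 = x_0` and
increments `p.2 i = h_{i+1}`. -/
def path (p : G × (ℕ → G)) (n : ℕ) : G :=
  p.1 * ((List.range n).map p.2).prod

theorem measurable_path [Countable G] [MeasurableSingletonClass G] :
    Measurable (path : G × (ℕ → G) → ℕ → G) := by
  refine measurable_pi_lambda _ fun n => ?_
  induction n with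
  | zero => simpa [path] using measurable_fst
  | succ n ih =>
    have h : (fun p : G × (ℕ → G) => path p (n + 1)) = fun p => path p n * p.2 n := by
      funext p
      simp [path, List.range_succ, mul_assoc]
    rw [h]
    exact (measurable_of_countable fun q : G × G => q.1 * q.2).comp
      (ih.prodMk ((measurable_pi_apply n).comp measurable_snd))

/-- The measure `𝐏_θ` on the path space: the law of the random walk with initial distribution `θ`
(a measure, not necessarily finite) and independent `μ`-distributed right increments. -/
def pathMeasure (μ : Measure G) [IsProbabilityMeasure μ] (θ : Measure G) : Measure (ℕ → G) :=
  (θ.prod (Measure.infinitePi fun _ : ℕ => μ)).map path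

/-- The measure `𝐏`: the law of the random walk started at the identity. -/
def walk (μ : Measure G) [IsProbabilityMeasure μ] : Measure (ℕ → G) :=
  pathMeasure μ (Measure.dirac 1)

/-- The measure `𝐏_m`, where `m` is the counting measure on `G`. -/
def walkCount (μ : Measure G) [IsProbabilityMeasure μ] : Measure (ℕ → G) :=
  pathMeasure μ Measure.count

/-- The time shift `T` in the path space. -/
def shift (x : ℕ → G) : ℕ → G := fun n => x (n + 1)

end PathSpace

section Boundary

variable {G : Type*} [Group G] [MeasurableSpace G]

/-- `bnd : G^{ℤ₊} → Γ` realizes the `G`-space `Γ` as the space of ergodic components of the time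
shift in `(G^{ℤ₊}, 𝐏_m)`: it is measurable, commutes with the action of `G` (which is
coordinate-wise on paths), and the `σ`-algebra of shift invariant measurable sets coincides mod
`𝐏_m` with the `σ`-algebra of preimages of measurable subsets of `Γ`. -/
structure IsPoissonBoundary (μ : Measure G) [IsProbabilityMeasure μ]
    {Γ : Type*} [MeasurableSpace Γ] [MulAction G Γ] (bnd : (ℕ → G) → Γ) : Prop where
  measurable : Measurable bnd
  equivariant : ∀ g : G, ∀ᵐ x ∂(walkCount μ), bnd (g • x) = g • bnd x
  preimage_invariant : ∀ E : Set Γ, MeasurableSet E →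
    ∃ A : Set (ℕ → G), MeasurableSet[MeasurableSpace.invariants shift] A ∧
      A =ᵐ[walkCount μ] bnd ⁻¹' E
  invariant_preimage : ∀ A : Set (ℕ → G), MeasurableSet[MeasurableSpace.invariants shift] A →
    ∃ E : Set Γ, MeasurableSet E ∧ A =ᵐ[walkCount μ] bnd ⁻¹' E

/-- The harmonic measure `ν = bnd(𝐏)` on the Poisson boundary. -/
def harmonicMeasure (μ : Measure G) [IsProbabilityMeasure μ]
    {Γ : Type*} [MeasurableSpace Γ] (bnd : (ℕ → G) → Γ) : Measure Γ :=
  (walk μ).map bnd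

/-- `quot : Γ → B` is the quotient map of the Poisson boundary `(Γ, ν)` by a `G`-invariant
measurable partition, namely the partition into the fibres of `quot`. The `μ`-boundary is then
`(B, quot(ν))`, and its projection from the path space is `quot ∘ bnd`. -/
structure IsMuBoundary (μ : Measure G) [IsProbabilityMeasure μ]
    {Γ : Type*} [MeasurableSpace Γ] [MulAction G Γ] (bnd : (ℕ → G) → Γ)
    {B : Type*} [MeasurableSpace B] [MulAction G B] (quot : Γ → B) : Prop where
  measurable : Measurable quot
  equivariant : ∀ g : G, ∀ᵐ γ ∂(harmonicMeasure μ bnd), quot (g • γ) = g • quot γ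

/-- `f` is an isomorphism mod 0 of the measure spaces `(X, ν)` and `(Y, ρ)`. -/
def IsIsoModZero {X Y : Type*} [MeasurableSpace X] [MeasurableSpace Y]
    (f : X → Y) (ν : Measure X) (ρ : Measure Y) : Prop :=
  MeasurePreserving f ν ρ ∧
    ∃ f' : Y → X, Measurable f' ∧ (∀ᵐ x ∂ν, f' (f x) = x) ∧ (∀ᵐ y ∂ρ, f (f' y) = y)

end Boundary

section Existence

universe u

/-- The Poisson boundary exists as a standard Borel `G`-space: a path `x` is mapped to the
conditional measures, with respect to the invariant `σ`-algebra, at its translates `g⁻¹ x`. -/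
theorem exists_isPoissonBoundary {G : Type u} [Group G] [Countable G] [MeasurableSpace G]
    [MeasurableSingletonClass G] (μ : Measure G) [IsProbabilityMeasure μ] :
    ∃ (Γ : Type u) (_ : MeasurableSpace Γ) (_ : StandardBorelSpace Γ) (_ : MulAction G Γ)
      (_ : MeasurableConstSMul G Γ) (bnd : (ℕ → G) → Γ), IsPoissonBoundary μ bnd := by
  have hsf : SFinite (walkCount μ) := by
    unfold walkCount pathMeasure; infer_instance
  let ρ := (walkCount μ).toFinite
  have hρ : ae ρ = ae (walkCount μ) := ae_toFinite
  have hle : MeasurableSpace.invariants (shift (G := G)) ≤ MeasurableSpace.pi :=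
    MeasurableSpace.invariants_le _
  let κ := ProbabilityTheory.condExpKernel ρ (MeasurableSpace.invariants (shift (G := G)))
  let e : (ℕ → G) → ℝ := embeddingReal (ℕ → G)
  have he : MeasurableEmbedding e := measurableEmbedding_embeddingReal _
  let bnd : (ℕ → G) → (G → ℚ → ENNReal) := fun x g r => κ (g⁻¹ • x) (e ⁻¹' Set.Iic (r : ℝ))
  have hbndI : Measurable[MeasurableSpace.invariants (shift (G := G))] bnd := by
    refine @measurable_pi_lambda _ _ _ (_) _ _ fun g => @measurable_pi_lambda _ _ _ (_) _ _ fun r => ?_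
    have h1 : Measurable[MeasurableSpace.invariants (shift (G := G))]
        fun x => κ x (e ⁻¹' Set.Iic (r : ℝ)) :=
      ProbabilityTheory.measurable_condExpKernel (he.measurable measurableSet_Iic)
    have h2 : @Measurable _ _ (MeasurableSpace.invariants (shift (G := G)))
        (MeasurableSpace.invariants (shift (G := G))) fun x : ℕ → G => g⁻¹ • x :=
      MeasurableSpace.measurable_invariants_of_semiconj
        (measurable_pi_lambda _ fun n => (measurable_of_countable _).comp (measurable_pi_apply n))
        (fun _ => rfl)
    exact @Measurable.comp _ _ _ (_) (_) _ _ _ h1 h2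
  have hbnd : Measurable bnd := hbndI.mono hle le_rfl
  let act : MulAction G (G → ℚ → ENNReal) := arrowAction
  refine ⟨G → ℚ → ENNReal, inferInstance, inferInstance, act, ⟨fun g => ?_⟩, bnd, hbnd, ?_, ?_, ?_⟩
  · exact measurable_pi_lambda _ fun a => measurable_pi_apply (g⁻¹ • a)
  · intro g
    refine Eventually.of_forall fun x => ?_
    funext a r
    change κ (a⁻¹ • g • x) _ = κ ((g⁻¹ • a)⁻¹ • x) _
    rw [smul_smul]
    simp
  · intro E hE
    exact ⟨bnd ⁻¹' E, hbndI hE, ae_eq_refl _⟩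
  · intro A hA
    have hmeas : ∀ S : Set (ℕ → G), MeasurableSet S →
        Measurable[MeasurableSpace.comap bnd inferInstance] fun x => κ x S := by
      have gen : (MeasurableSpace.pi : MeasurableSpace (ℕ → G)) =
          MeasurableSpace.generateFrom (Set.preimage e '' (⋃ a : ℚ, {Set.Iic (a : ℝ)})) := by
        rw [← he.comap_eq, BorelSpace.measurable_eq (α := ℝ), Real.borel_eq_generateFrom_Iic_rat,
          MeasurableSpace.comap_generateFrom]
      refine fun S hS => MeasurableSpace.induction_on_inter gen
        (Real.isPiSystem_Iic_rat.comap e) ?_ ?_ ?_ ?_ S hS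
      · simp
      · rintro _ ⟨s, hs, rfl⟩
        simp only [Set.mem_iUnion, Set.mem_singleton_iff] at hs
        obtain ⟨r, rfl⟩ := hs
        have : (fun x => κ x (e ⁻¹' Set.Iic (r : ℝ))) =
            (fun γ : G → ℚ → ENNReal => γ 1 r) ∘ bnd := by
          funext x; simp [bnd]
        rw [this]
        exact Measurable.comp ((measurable_pi_apply r).comp (measurable_pi_apply (1 : G)))
          (comap_measurable bnd)
      · intro t ht hm
        have : (fun x => κ x tᶜ) = fun x => 1 - κ x t := by
          funext x; exact prob_compl_eq_one_sub ht
        rw [this]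
        exact measurable_const.sub hm
      · intro f hd hf hm
        have : (fun x => κ x (⋃ i, f i)) = fun x => ∑' i, κ x (f i) := by
          funext x; exact measure_iUnion hd hf
        rw [this]
        exact Measurable.ennreal_tsum hm
    obtain ⟨E, hE, hEA⟩ := hmeas A (hle A hA) (measurableSet_singleton 1)
    refine ⟨E, hE, ?_⟩
    have h1 := ProbabilityTheory.condExpKernel_ae_eq_condExp (μ := ρ) hle (hle A hA)
    rw [condExp_of_stronglyMeasurable hle
      ((stronglyMeasurable_const (b := (1 : ℝ))).indicator hA)
      ((integrable_const (1 : ℝ)).indicator (hle A hA))] at h1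
    rw [EventuallyEq, hρ] at h1
    filter_upwards [h1] with x hx
    rw [hEA]
    refine propext ?_
    change A x ↔ κ x A = 1
    change (κ x A).toReal = _ at hx
    by_cases hxA : x ∈ A
    · rw [Set.indicator_of_mem hxA] at hx
      exact ⟨fun _ => (ENNReal.toReal_eq_one_iff _).1 hx, fun _ => hxA⟩
    · rw [Set.indicator_of_notMem hxA] at hx
      refine ⟨fun h => absurd h hxA, fun h => ?_⟩
      rw [h] at hx
      simp at hx

end Existence

end RandomWalk

end

/-!
Write `ν` for the harmonic measure of a space `X` of boundary values and `D_g` for the density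
`d(gν)/dν`. Given the boundary value `b`, the walk is at `x_n = g` with probability
`P(x_n = g) * D_g b`, so the conditional information of `x_n` is `-log P(x_n) - log D_{x_n} b`.
Along the sample path `log D_{x_n} b` is a Birkhoff sum, whose mean `h X` is the Furstenberg
entropy of `X`, and `-log P(x_n)` has expectation `H_n`; hence the conditional entropy of `x_n`
is `H_n - n * h X`, which is nonnegative.

If gauges as in the theorem exist on the quotient `Y`, then given the point of `Y` the position
`x_n` lies, up to small probability, in a set of `exp (o(n))` elements, so that its conditional
entropy is `o(n)`. Thus `h X ≤ H_n / n ≤ h Y + o(1)` and `h X ≤ h Y`. On the other hand the density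
on `Y` is the conditional expectation of the density on `X`, and the equality case of
`log r ≤ r - 1` makes every density `D_g` charged by the walk factor through the quotient map `q`.
For a bounded injective `e : X → ℝ`, the function `e - E[e | q]` then has integral zero against
every such `gν`. These integrals are the conditional expectations of `e - E[e | q]` given the first
`n` steps of the walk, so it vanishes almost everywhere, which means that `q` is injective mod 0.
-/

namespace RandomWalk

section BirkhoffSum

variable {Ω : Type*} [MeasurableSpace Ω] {ρ : Measure Ω} {T : Ω → Ω} {Y : Ω → ℝ}

theorem integrable_birkhoffSum (hT : MeasurePreserving T ρ ρ) (hY : Integrable Y ρ) (n : ℕ) :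
    Integrable (birkhoffSum T Y n) ρ :=
  integrable_finsetSum _ fun i _ => (hT.iterate i).integrable_comp_of_integrable hY

theorem integral_birkhoffSum (hT : MeasurePreserving T ρ ρ) (hY : Integrable Y ρ) (n : ℕ) :
    ∫ ω, birkhoffSum T Y n ω ∂ρ = n * ∫ ω, Y ω ∂ρ := by
  have hconst (i : ℕ) : ∫ ω, Y (T^[i] ω) ∂ρ = ∫ ω, Y ω ∂ρ := by
    have hi := hT.iterate i
    conv_rhs => rw [← hi.map_eq]
    exact (integral_map hi.aemeasurable (by rw [hi.map_eq]; exact hY.aestronglyMeasurable)).symm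
  have hint (i : ℕ) : Integrable (fun ω => Y (T^[i] ω)) ρ :=
    (hT.iterate i).integrable_comp_of_integrable hY
  simp only [birkhoffSum, integral_finsetSum _ fun i _ => hint i, hconst, Finset.sum_const,
    Finset.card_range, nsmul_eq_mul]

theorem ae_le_birkhoffSum (hT : Measure.QuasiMeasurePreserving T ρ ρ) {J : ℕ → Ω → ℝ}
    (h_zero : J 0 ≤ᵐ[ρ] 0) (h_succ : ∀ n, ∀ᵐ ω ∂ρ, J (n + 1) ω ≤ Y ω + J n (T ω)) (n : ℕ) :
    J n ≤ᵐ[ρ] birkhoffSum T Y n := by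
  induction n with
  | zero => exact h_zero
  | succ n ih =>
    filter_upwards [h_succ n, hT.ae ih] with ω h₁ h₂
    rw [birkhoffSum_succ']
    exact h₁.trans (by gcongr)

theorem uniformIntegrable_birkhoffSum_div [IsFiniteMeasure ρ] (hT : MeasurePreserving T ρ ρ)
    (hY : Integrable Y ρ) :
    UniformIntegrable (fun (n : ℕ) ω => birkhoffSum T Y n ω / n) 1 ρ := by
  have hident (i : ℕ) : ProbabilityTheory.IdentDistrib (Y ∘ T^[i]) (Y ∘ T^[0]) ρ ρ := by
    have hi := hT.iterate i
    have hT_id : ProbabilityTheory.IdentDistrib T^[i] T^[0] ρ ρ :=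
      ⟨hi.aemeasurable, aemeasurable_id, hi.map_eq.trans Measure.map_id.symm⟩
    exact hT_id.comp_of_aemeasurable (by rw [hi.map_eq]; exact hY.aemeasurable)
  convert! uniformIntegrable_average_real le_rfl
    (ProbabilityTheory.MemLp.uniformIntegrable_of_identDistrib (j := 0) le_rfl ENNReal.one_ne_top
      (memLp_one_iff_integrable.2 hY) hident) using 3
  simp [birkhoffSum]

theorem integral_div_le_add_of_le_birkhoffSum [IsProbabilityMeasure ρ]
    (hT : MeasurePreserving T ρ ρ) (hY : Integrable Y ρ) {f : Ω → ℝ} (hf : Measurable f) {n : ℕ}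
    (hf_nonneg : 0 ≤ᵐ[ρ] f) (hfY : f ≤ᵐ[ρ] birkhoffSum T Y n) {δ : ℝ} (hδ : 0 ≤ δ) (hn : 0 < n) :
    (∫ ω, f ω ∂ρ) / n ≤
      δ + ∫ ω, |{ω | δ * n < f ω}.indicator (fun ω => birkhoffSum T Y n ω / n) ω| ∂ρ := by
  have hn' : (0 : ℝ) < n := Nat.cast_pos.2 hn
  have hE : MeasurableSet {ω | δ * n < f ω} := measurableSet_lt measurable_const hf
  have hS := integrable_birkhoffSum hT hY n
  have hint := ((hS.div_const n).indicator hE).abs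
  have hpt : ∀ᵐ ω ∂ρ, f ω / n ≤
      δ + |{ω | δ * n < f ω}.indicator (fun ω => birkhoffSum T Y n ω / n) ω| := by
    filter_upwards [hfY] with ω hω
    by_cases h : δ * n < f ω
    · rw [Set.indicator_of_mem (s := {ω | δ * n < f ω}) h]
      exact (div_le_div_of_nonneg_right hω hn'.le).trans
        ((le_abs_self _).trans (le_add_of_nonneg_left hδ))
    · exact ((div_le_iff₀ hn').2 (not_lt.1 h)).trans (le_add_of_nonneg_right (abs_nonneg _))
  have hf_int : Integrable f ρ := hS.mono' hf.aestronglyMeasurable <| by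
    filter_upwards [hf_nonneg, hfY] with ω h₀ h
    exact (Real.norm_of_nonneg h₀).trans_le h
  rw [← integral_div]
  refine (integral_mono_ae (hf_int.div_const n) ((integrable_const δ).add hint) hpt).trans_eq ?_
  simp only [Pi.add_apply]
  rw [integral_add (integrable_const δ) hint]
  simp

theorem tendsto_integral_div_of_le_birkhoffSum [IsProbabilityMeasure ρ]
    (hT : MeasurePreserving T ρ ρ) (hY : Integrable Y ρ) {J : ℕ → Ω → ℝ}
    (hJ : ∀ n, Measurable (J n)) (hJ_nonneg : ∀ n, 0 ≤ᵐ[ρ] J n)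
    (hJY : ∀ n, J n ≤ᵐ[ρ] birkhoffSum T Y n)
    (hlim : ∀ δ : ℝ, 0 < δ → Tendsto (fun n : ℕ => ρ {ω | δ * n < J n ω}) atTop (𝓝 0)) :
    Tendsto (fun n : ℕ => (∫ ω, J n ω ∂ρ) / n) atTop (𝓝 0) := by
  refine tendsto_order.2 ⟨fun a ha => Eventually.of_forall fun n =>
    ha.trans_le (div_nonneg (integral_nonneg_of_ae (hJ_nonneg n)) n.cast_nonneg), fun a ha => ?_⟩
  obtain ⟨η, hη, hUI⟩ := (uniformIntegrable_birkhoffSum_div hT hY).unifIntegrable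
    (show 0 < a / 3 by positivity)
  have hsmall := (hlim (a / 3) (by positivity)).eventually_le_const (ENNReal.ofReal_pos.2 hη)
  filter_upwards [hsmall, eventually_gt_atTop 0] with n hn hn₀
  have hE : MeasurableSet {ω | a / 3 * n < J n ω} := measurableSet_lt measurable_const (hJ n)
  have htail := hUI n _ hE hn
  have hae := ((integrable_birkhoffSum hT hY n).div_const n).indicator hE
  rw [eLpNorm_one_eq_lintegral_enorm, ← ofReal_integral_norm_eq_lintegral_enorm hae,
    ENNReal.ofReal_le_ofReal_iff (by positivity)] at htail
  have := integral_div_le_add_of_le_birkhoffSum hT hY (hJ n) (hJ_nonneg n) (hJY n)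
    (show 0 ≤ a / 3 by positivity) hn₀
  simp only [Real.norm_eq_abs] at htail
  linarith

end BirkhoffSum

section Jensen

variable {Ω : Type*} [MeasurableSpace Ω] {ρ : Measure Ω} [IsProbabilityMeasure ρ]

theorem ae_eq_one_of_integral_log_nonneg {R : Ω → ℝ} (hpos : ∀ᵐ ω ∂ρ, 0 < R ω)
    (hR : Integrable R ρ) (hlog : Integrable (fun ω => Real.log (R ω)) ρ)
    (hR_le : ∫ ω, R ω ∂ρ ≤ 1) (hlog_nonneg : 0 ≤ ∫ ω, Real.log (R ω) ∂ρ) : R =ᵐ[ρ] 1 := by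
  have hsub : Integrable (fun ω => R ω - 1) ρ := hR.sub (integrable_const 1)
  have hle : (fun ω => Real.log (R ω)) ≤ᵐ[ρ] fun ω => R ω - 1 :=
    hpos.mono fun ω => Real.log_le_sub_one_of_pos
  have heq : ∫ ω, Real.log (R ω) ∂ρ = ∫ ω, R ω - 1 ∂ρ := by
    refine le_antisymm (integral_mono_ae hlog hsub hle) ?_
    rw [integral_sub hR (integrable_const 1)]
    simp only [integral_const, probReal_univ, smul_eq_mul, mul_one]
    linarith
  filter_upwards [hpos, (integral_eq_iff_of_ae_le hlog hsub hle).1 heq] with ω h₀ h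
  by_contra hne
  exact (Real.log_lt_sub_one_of_pos h₀ hne).ne h

end Jensen

section Determination

theorem ae_eq_zero_of_forall_setIntegral_isPiSystem_eq_zero {Ω E : Type*} [MeasurableSpace Ω]
    [NormedAddCommGroup E] [NormedSpace ℝ E] [CompleteSpace E] {ρ : Measure Ω} {f : Ω → E}
    (hf : Integrable f ρ) {C : Set (Set Ω)} (hgen : ‹MeasurableSpace Ω› = .generateFrom C)
    (hC : IsPiSystem C) (huniv : Set.univ ∈ C) (hzero : ∀ A ∈ C, ∫ ω in A, f ω ∂ρ = 0) :
    f =ᵐ[ρ] 0 := by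
  suffices h : ∀ A, MeasurableSet A → ∫ ω in A, f ω ∂ρ = 0 from
    hf.ae_eq_zero_of_forall_setIntegral_eq_zero fun A hA _ => h A hA
  intro A hA
  induction A, hA using MeasurableSpace.induction_on_inter hgen hC with
  | empty => simp
  | basic A hA => exact hzero A hA
  | compl A hA ih =>
    rw [setIntegral_compl hA hf, ← setIntegral_univ, hzero _ huniv, ih, sub_zero]
  | iUnion A hd hA ih =>
    rw [integral_iUnion hA hd hf.integrableOn]
    simp [ih]

theorem integral_smul_sub_condExp_eq_zero {Ω : Type*} {m m₀ : MeasurableSpace Ω} {ρ : Measure Ω}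
    [IsFiniteMeasure ρ] (hm : m ≤ m₀) {w e : Ω → ℝ} (hw : StronglyMeasurable[m] w)
    (he : Integrable e ρ) (hwe : Integrable (w * e) ρ) :
    ∫ ω, w ω • (e ω - (ρ[e|m]) ω) ∂ρ = 0 := by
  have hpull : ρ[w * e|m] =ᵐ[ρ] w * ρ[e|m] := condExp_mul_of_stronglyMeasurable_left hw hwe he
  have hpull_int : Integrable (w * ρ[e|m]) ρ := integrable_condExp.congr hpull
  simp only [smul_eq_mul, mul_sub]
  refine (integral_sub hwe hpull_int).trans ?_
  rw [← integral_congr_ae hpull, integral_condExp hm, sub_self]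

theorem exists_bounded_measurableEmbedding_real (X : Type*) [MeasurableSpace X]
    [StandardBorelSpace X] : ∃ e : X → ℝ, MeasurableEmbedding e ∧ ∃ c, ∀ x, ‖e x‖ ≤ c := by
  refine ⟨Real.arctan ∘ embeddingReal X,
    (Real.continuous_arctan.measurableEmbedding Real.arctan_injective).comp
      (measurableEmbedding_embeddingReal X), Real.pi / 2, fun x => ?_⟩
  rw [Real.norm_eq_abs, abs_le]
  exact ⟨(Real.neg_pi_div_two_lt_arctan _).le, (Real.arctan_lt_pi_div_two _).le⟩

theorem isIsoModZero_of_ae_eq_comp {X Y Z : Type*} [MeasurableSpace X] [Nonempty X]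
    [MeasurableSpace Y] [MeasurableEq Y] [MeasurableSpace Z] {ν : Measure X} {q : X → Y}
    (hq : Measurable q) {e : X → Z} (he : MeasurableEmbedding e) {k : Y → Z} (hk : Measurable k)
    (h : ∀ᵐ x ∂ν, e x = k (q x)) : IsIsoModZero q ν (ν.map q) := by
  have hinv : ∀ᵐ x ∂ν, he.invFun (k (q x)) = x := by
    filter_upwards [h] with x hx
    rw [← hx, he.leftInverse_invFun x]
  have hmeas : Measurable fun y => he.invFun (k y) := he.measurable_invFun.comp hk
  have hset : MeasurableSet {y | q (he.invFun (k y)) = y} :=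
    measurableSet_eq_fun (hq.comp hmeas) measurable_id
  exact ⟨⟨hq, rfl⟩, _, hmeas, hinv,
    (ae_map_iff hq.aemeasurable hset).2 (hinv.mono fun x => congrArg q)⟩

end Determination

section Gauge

variable {G ι : Type*}

theorem Gauge.mem_of_norm_le (𝒢 : Gauge G) {g : G} {k : ℕ+} (h : 𝒢.norm g ≤ k) :
    g ∈ 𝒢.sets k := by
  obtain ⟨k₀, hk₀⟩ := 𝒢.exhausts g
  obtain ⟨hpos, hmem⟩ := Nat.sInf_mem (s := {k : ℕ | ∃ h : 0 < k, g ∈ 𝒢.sets ⟨k, h⟩})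
    ⟨k₀, k₀.pos, hk₀⟩
  exact 𝒢.mono (a := ⟨_, hpos⟩) h hmem

theorem UniformlyTemperate.exists_ncard_le_exp {𝒢 : ι → Gauge G} (h𝒢 : UniformlyTemperate 𝒢) :
    ∃ C : ℝ, 0 < C ∧ ∀ a k, (((𝒢 a).sets k).ncard : ℝ) ≤ Real.exp (C * k) := by
  obtain ⟨-, C, hC⟩ := h𝒢
  refine ⟨max C 1, by positivity, fun a k => ?_⟩
  obtain h | h := (Nat.cast_nonneg (α := ℝ) ((𝒢 a).sets k).ncard).eq_or_lt
  · exact h ▸ (Real.exp_pos _).le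
  · have hk : (0 : ℝ) < k := Nat.cast_pos.2 k.pos
    rw [← Real.log_le_iff_le_exp h, ← div_le_iff₀ hk, div_eq_inv_mul, ← one_div]
    exact (hC a k).trans (le_max_left C 1)

variable [Group G]

/-- The left translate of a gauge, in which `g` has the norm that `a⁻¹ * g` has in `𝒢`. -/
def Gauge.translate (a : G) (𝒢 : Gauge G) : Gauge G where
  sets k := {g | a⁻¹ * g ∈ 𝒢.sets k}
  mono _ _ h _ hg := 𝒢.mono h hg
  exhausts g := 𝒢.exhausts (a⁻¹ * g)

theorem Gauge.norm_translate (a : G) (𝒢 : Gauge G) (g : G) :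
    (𝒢.translate a).norm g = 𝒢.norm (a⁻¹ * g) := rfl

theorem Gauge.sets_translate (a : G) (𝒢 : Gauge G) (k : ℕ+) :
    (𝒢.translate a).sets k = (a * ·) '' 𝒢.sets k :=
  Set.image_mul_left.symm

theorem Gauge.Temperate.uniformlyTemperate_translate {𝒢 : Gauge G} (h𝒢 : 𝒢.Temperate)
    (a : ι → G) : UniformlyTemperate fun i => 𝒢.translate (a i) := by
  obtain ⟨hfin, C, hC⟩ := h𝒢
  refine ⟨fun i k => ?_, C, fun i k => ?_⟩ <;> rw [Gauge.sets_translate]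
  · exact (hfin k).image _
  · rw [Set.ncard_image_of_injective _ (mul_right_injective _)]
    exact hC k

end Gauge

section Information

variable {Ω G : Type*} [MeasurableSpace Ω]

/-- The information content (surprisal) `-log ρ(X = X ω)` of the value at `ω` of a discrete random
variable `X`. It is nonnegative as soon as `ρ` is a probability measure, also where
`ρ(X = X ω) = 0`, since `Real.log 0 = 0`. -/
noncomputable def info (ρ : Measure Ω) (X : Ω → G) (ω : Ω) : ℝ :=
  -Real.log (ρ.real (X ⁻¹' {X ω}))

theorem info_nonneg (ρ : Measure Ω) [IsZeroOrProbabilityMeasure ρ] (X : Ω → G) (ω : Ω) :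
    0 ≤ info ρ X ω :=
  neg_nonneg.2 (Real.log_nonpos measureReal_nonneg measureReal_le_one)

theorem measure_mem_inter_lt_info_le (ρ : Measure Ω) [IsFiniteMeasure ρ] (X : Ω → G) {A : Set G}
    (hA : A.Finite) (c : ℝ) :
    ρ {ω | X ω ∈ A ∧ c < info ρ X ω} ≤ ENNReal.ofReal (A.ncard * Real.exp (-c)) := by
  have hatom {ω : Ω} (h : c < info ρ X ω) : ρ (X ⁻¹' {X ω}) ≤ ENNReal.ofReal (Real.exp (-c)) := by
    rw [← ofReal_measureReal]
    refine ENNReal.ofReal_le_ofReal ?_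
    obtain h₀ | h₀ := measureReal_nonneg (μ := ρ) (s := X ⁻¹' {X ω}) |>.eq_or_lt
    · exact h₀ ▸ (Real.exp_pos _).le
    · exact (Real.log_le_iff_le_exp h₀).1 (le_neg_of_le_neg h.le)
  set S := {g ∈ A | ρ (X ⁻¹' {g}) ≤ ENNReal.ofReal (Real.exp (-c))}
  have hS_fin : S.Finite := hA.sep _
  calc ρ {ω | X ω ∈ A ∧ c < info ρ X ω}
      ≤ ρ (⋃ g ∈ hS_fin.toFinset, X ⁻¹' {g}) := measure_mono fun ω hω => by
        simpa [S] using ⟨hω.1, hatom hω.2⟩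
    _ ≤ ∑ g ∈ hS_fin.toFinset, ρ (X ⁻¹' {g}) := measure_biUnion_finset_le _ _
    _ ≤ S.ncard • ENNReal.ofReal (Real.exp (-c)) := by
        rw [Set.ncard_eq_toFinset_card S hS_fin]
        exact Finset.sum_le_card_nsmul _ _ _ fun g hg => (hS_fin.mem_toFinset.1 hg).2
    _ ≤ A.ncard • ENNReal.ofReal (Real.exp (-c)) :=
        nsmul_le_nsmul_left zero_le (Set.ncard_le_ncard (Set.sep_subset _ _) hA)
    _ = ENNReal.ofReal (A.ncard * Real.exp (-c)) := by
        rw [nsmul_eq_mul, ENNReal.ofReal_mul (Nat.cast_nonneg _), ENNReal.ofReal_natCast]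

theorem measure_lt_info_le_measure_norm_gt_add (ρ : Measure Ω) [IsFiniteMeasure ρ] (X : Ω → G)
    {𝒢 : Gauge G} (hfin : ∀ k, (𝒢.sets k).Finite) {C : ℝ} (hC : 0 ≤ C)
    (hcard : ∀ k, ((𝒢.sets k).ncard : ℝ) ≤ Real.exp (C * k)) {r : ℝ} (hr : 0 ≤ r) (c : ℝ) :
    ρ {ω | c < info ρ X ω} ≤
      ρ {ω | r < 𝒢.norm (X ω)} + ENNReal.ofReal (Real.exp (C * (r + 1) - c)) := by
  let k : ℕ+ := ⌊r⌋₊.succPNat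
  have hk : (k : ℝ) ≤ r + 1 := by simpa [k] using Nat.floor_le hr
  have hsubset : {ω | c < info ρ X ω} ⊆
      {ω | r < 𝒢.norm (X ω)} ∪ {ω | X ω ∈ 𝒢.sets k ∧ c < info ρ X ω} := by
    intro ω hω
    by_cases h : r < 𝒢.norm (X ω)
    · exact .inl h
    · exact .inr ⟨𝒢.mem_of_norm_le ((Nat.le_floor (not_lt.1 h)).trans (Nat.le_succ _)), hω⟩
  have hcount : (𝒢.sets k).ncard * Real.exp (-c) ≤ Real.exp (C * (r + 1) - c) := by
    rw [sub_eq_add_neg, Real.exp_add]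
    gcongr
    exact (hcard k).trans (by gcongr)
  calc ρ {ω | c < info ρ X ω}
      ≤ ρ {ω | r < 𝒢.norm (X ω)} + ρ {ω | X ω ∈ 𝒢.sets k ∧ c < info ρ X ω} :=
        (measure_mono hsubset).trans (measure_union_le _ _)
    _ ≤ ρ {ω | r < 𝒢.norm (X ω)} + ENNReal.ofReal (Real.exp (C * (r + 1) - c)) := by
        gcongr
        exact (measure_mem_inter_lt_info_le ρ X (hfin k) c).trans
          (ENNReal.ofReal_le_ofReal hcount)

variable [MeasurableSpace G] [Countable G] [MeasurableSingletonClass G]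

theorem tendsto_measure_norm_gt (ρ : Measure Ω) [IsFiniteMeasure ρ] {X : ℕ → Ω → G}
    (hX : ∀ n, Measurable (X n)) {𝒢 : ℕ → Gauge G}
    (hlim : ∀ᵐ ω ∂ρ, Tendsto (fun n : ℕ => 1 / (n : ℝ) * ((𝒢 n).norm (X n ω) : ℝ)) atTop (𝓝 0))
    {ε : ℝ} (hε : 0 < ε) :
    Tendsto (fun n : ℕ => ρ {ω | ε * n < (𝒢 n).norm (X n ω)}) atTop (𝓝 0) := by
  have hmeas (n : ℕ) : MeasurableSet {ω | ε * n < (𝒢 n).norm (X n ω)} :=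
    hX n (Set.to_countable {g | ε * n < (𝒢 n).norm g}).measurableSet
  rw [← measure_empty (μ := ρ)]
  refine tendsto_measure_of_ae_tendsto_indicator_of_isFiniteMeasure atTop .empty hmeas ?_
  filter_upwards [hlim] with ω hω
  filter_upwards [hω.eventually_lt_const hε, eventually_gt_atTop 0] with n hn hn₀
  rw [one_div, inv_mul_lt_iff₀ (Nat.cast_pos.2 hn₀), mul_comm] at hn
  simpa using hn.le

theorem tendsto_measure_lt_info_of_gauge (ρ : Measure Ω) [IsFiniteMeasure ρ] {X : ℕ → Ω → G}
    (hX : ∀ n, Measurable (X n)) {𝒢 : ℕ → Gauge G} (h𝒢 : UniformlyTemperate 𝒢)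
    (hlim : ∀ᵐ ω ∂ρ, Tendsto (fun n : ℕ => 1 / (n : ℝ) * ((𝒢 n).norm (X n ω) : ℝ)) atTop (𝓝 0))
    {δ : ℝ} (hδ : 0 < δ) :
    Tendsto (fun n : ℕ => ρ {ω | δ * n < info ρ (X n) ω}) atTop (𝓝 0) := by
  obtain ⟨C, hC, hcard⟩ := h𝒢.exists_ncard_le_exp
  set ε := δ / (2 * C) with hε
  have hε_pos : 0 < ε := by positivity
  have hexponent (n : ℕ) : C * (ε * n + 1) - δ * n = C - δ / 2 * n := by
    rw [hε]
    field_simp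
    ring
  have hbound (n : ℕ) : ρ {ω | δ * n < info ρ (X n) ω} ≤ ρ {ω | ε * n < (𝒢 n).norm (X n ω)} +
      ENNReal.ofReal (Real.exp (C - δ / 2 * n)) :=
    hexponent n ▸ measure_lt_info_le_measure_norm_gt_add ρ (X n) (h𝒢.1 n) hC.le (hcard n)
      (by positivity) _
  have hexp : Tendsto (fun n : ℕ => ENNReal.ofReal (Real.exp (C - δ / 2 * n))) atTop (𝓝 0) := by
    rw [← ENNReal.ofReal_zero]
    refine ENNReal.tendsto_ofReal (Real.tendsto_exp_atBot.comp
      (tendsto_atBot_add_const_left _ C (tendsto_neg_atTop_atBot.comp ?_)))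
    exact tendsto_natCast_atTop_atTop.const_mul_atTop (by positivity)
  have hsum := (tendsto_measure_norm_gt ρ hX hlim hε_pos).add hexp
  rw [add_zero] at hsum
  exact tendsto_of_tendsto_of_tendsto_of_le_of_le tendsto_const_nhds hsum (fun _ => zero_le) hbound

end Information

section Splice

variable {α : Type*}

/-- The sequence consisting of the first `n` terms of `p.1`, followed by all the terms of `p.2`. -/
def splice (n : ℕ) (p : (ℕ → α) × (ℕ → α)) : ℕ → α :=
  fun i => if i < n then p.1 i else p.2 (i - n)

theorem splice_add (n i : ℕ) (p : (ℕ → α) × (ℕ → α)) : splice n p (n + i) = p.2 i := by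
  simp [splice]

theorem splice_of_lt {n i : ℕ} (h : i < n) (p : (ℕ → α) × (ℕ → α)) : splice n p i = p.1 i :=
  if_pos h

theorem preimage_splice_pi (n : ℕ) (s : Finset ℕ) (t : ℕ → Set α) :
    splice n ⁻¹' Set.pi s t = Set.pi (s.filter (· < n) : Finset ℕ) t ×ˢ
      Set.pi (s.preimage (n + ·) (add_right_injective n).injOn : Finset ℕ)
        fun i => t (n + i) := by
  ext p
  simp only [Set.mem_preimage, Set.mem_prod, Set.mem_pi, Finset.mem_coe, Finset.mem_filter,
    Finset.mem_preimage]
  constructor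
  · intro h
    exact ⟨fun i hi => splice_of_lt hi.2 p ▸ h i hi.1, fun i hi => splice_add n i p ▸ h _ hi⟩
  · rintro ⟨hlt, hge⟩ i hi
    obtain hin | ⟨j, rfl⟩ := (lt_or_ge i n).imp_right Nat.exists_eq_add_of_le
    · exact splice_of_lt hin p ▸ hlt i ⟨hi, hin⟩
    · exact splice_add n j p ▸ hge j hi

variable [MeasurableSpace α]

theorem measurable_splice (n : ℕ) : Measurable (splice (α := α) n) := by
  refine measurable_pi_lambda _ fun i => ?_
  unfold splice
  split_ifs <;> fun_prop

theorem measurePreserving_splice (μ : Measure α) [IsProbabilityMeasure μ] (n : ℕ) :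
    MeasurePreserving (splice n)
      ((Measure.infinitePi fun _ : ℕ => μ).prod (Measure.infinitePi fun _ : ℕ => μ))
      (Measure.infinitePi fun _ : ℕ => μ) := by
  refine ⟨measurable_splice n, Measure.eq_infinitePi _ fun s t ht => ?_⟩
  rw [Measure.map_apply (measurable_splice n) (.pi s.countable_toSet fun i _ => ht i),
    preimage_splice_pi, Measure.prod_prod, Measure.infinitePi_pi _ fun i _ => ht i,
    Measure.infinitePi_pi _ fun i _ => ht (n + i)]
  classical
  rw [Finset.prod_preimage' (n + ·) s (add_right_injective n).injOn fun i => μ (t i),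
    ← Finset.prod_filter_mul_prod_filter_not s (· < n)]
  congr 2
  refine Finset.filter_congr fun i _ => ?_
  rw [not_lt, Set.mem_range]
  exact ⟨fun ⟨j, hj⟩ => hj ▸ Nat.le_add_right n j, fun h => ⟨i - n, Nat.add_sub_cancel' h⟩⟩

end Splice

section Walk

variable {G : Type*} [Group G]

/-- The path that follows `p.1` up to time `n` and then continues by the translate of `p.2` by the
position `p.1 n`. -/
def concat (n : ℕ) (p : (ℕ → G) × (ℕ → G)) : ℕ → G :=
  fun i => if i < n then p.1 i else p.1 n * p.2 (i - n)

/-- The path after the first step, translated so as to start at the identity. Unlike `shift`, this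
preserves the finite measure `walk μ`. -/
def restart (x : ℕ → G) : ℕ → G := fun n => (x 1)⁻¹ * x (n + 1)

theorem concat_add (n i : ℕ) (p : (ℕ → G) × (ℕ → G)) :
    concat n p (n + i) = p.1 n * p.2 i := by
  simp [concat]

theorem concat_of_lt {n i : ℕ} (h : i < n) (p : (ℕ → G) × (ℕ → G)) : concat n p i = p.1 i :=
  if_pos h

theorem concat_of_le {n i : ℕ} {p : (ℕ → G) × (ℕ → G)} (hp : p.2 0 = 1) (h : i ≤ n) :
    concat n p i = p.1 i := by
  obtain h | rfl := h.lt_or_eq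
  · exact concat_of_lt h p
  · simp [concat, hp]

theorem mul_restart (x : ℕ → G) (n : ℕ) : x 1 * restart x n = x (n + 1) :=
  mul_inv_cancel_left _ _

theorem smul_restart (x : ℕ → G) : x 1 • restart x = shift x :=
  funext (mul_restart x)

theorem restart_iterate {x : ℕ → G} (hx : x 0 = 1) (n : ℕ) :
    restart^[n] x = fun i => (x n)⁻¹ * x (n + i) := by
  induction n with
  | zero => simp [hx]
  | succ n ih =>
    rw [Function.iterate_succ_apply', ih]
    funext i
    simp [restart, add_comm i, add_assoc]

theorem restart_iterate_concat {n : ℕ} {p : (ℕ → G) × (ℕ → G)} (h₁ : p.1 0 = 1)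
    (h₂ : p.2 0 = 1) : restart^[n] (concat n p) = p.2 := by
  rw [restart_iterate ((concat_of_le h₂ n.zero_le).trans h₁), concat_of_le h₂ le_rfl]
  simp [concat_add]

theorem path_splice (n : ℕ) (p : (ℕ → G) × (ℕ → G)) :
    path (1, splice n p) = concat n (path (1, p.1), path (1, p.2)) := by
  have agree {m : ℕ} (hm : m ≤ n) : (List.range m).map (splice n p) = (List.range m).map p.1 :=
    List.map_congr_left fun i hi => splice_of_lt ((List.mem_range.1 hi).trans_le hm) p
  funext i
  obtain hi | ⟨k, rfl⟩ := (lt_or_ge i n).imp_right Nat.exists_eq_add_of_le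
  · simp only [concat_of_lt hi, path, agree hi.le]
  · rw [concat_add]
    simp only [path, one_mul, List.range_add, List.map_append, List.prod_append, agree le_rfl,
      List.map_map]
    congr 3
    funext j
    exact splice_add n j p

variable [MeasurableSpace G]

theorem measurable_restart [MeasurableMul₂ G] [MeasurableInv G] :
    Measurable (restart (G := G)) := by
  unfold restart
  fun_prop

theorem measurable_concat [MeasurableMul₂ G] (n : ℕ) : Measurable (concat (G := G) n) := by
  refine measurable_pi_lambda _ fun i => ?_
  unfold concat
  split_ifs <;> fun_prop

variable (μ : Measure G) [IsProbabilityMeasure μ]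

/-- The law of the position of the random walk at time `n`, that is, the `n`-fold convolution power
of `μ`. -/
noncomputable def posLaw (n : ℕ) : Measure G := (walk μ).map fun x => x n

theorem measurePreserving_eval (n : ℕ) :
    MeasurePreserving (fun x => x n) (walk μ) (posLaw μ n) :=
  ⟨measurable_pi_apply n, rfl⟩

theorem ae_posLaw_ne_zero [Countable G] (n : ℕ) : ∀ᵐ x ∂walk μ, posLaw μ n {x n} ≠ 0 :=
  have h : ∀ᵐ g ∂posLaw μ n, posLaw μ n {g} ≠ 0 := ae_iff_of_countable.2 fun _ hg => hg
  (measurePreserving_eval μ n).quasiMeasurePreserving.ae h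

variable [Countable G] [MeasurableSingletonClass G]

theorem walk_eq_map :
    walk μ = (Measure.infinitePi fun _ : ℕ => μ).map fun ω => path (1, ω) := by
  rw [walk, pathMeasure, Measure.dirac_prod, Measure.map_map measurable_path (by fun_prop)]
  rfl

instance : IsProbabilityMeasure (walk μ) :=
  walk_eq_map μ ▸
    Measure.isProbabilityMeasure_map (measurable_path.comp measurable_prodMk_left).aemeasurable

theorem measurePreserving_path :
    MeasurePreserving (fun ω => path (1, ω)) (Measure.infinitePi fun _ : ℕ => μ) (walk μ) :=
  ⟨measurable_path.comp measurable_prodMk_left, (walk_eq_map μ).symm⟩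

theorem ae_walk_zero : ∀ᵐ x ∂walk μ, x 0 = 1 := by
  have h : MeasurableSet {x : ℕ → G | x 0 = 1} :=
    measurable_pi_apply 0 (measurableSet_singleton 1)
  rw [walk_eq_map, ae_map_iff (measurePreserving_path μ).measurable.aemeasurable h]
  exact Eventually.of_forall fun ω => by simp [path]

theorem measurePreserving_concat (n : ℕ) :
    MeasurePreserving (concat n) ((walk μ).prod (walk μ)) (walk μ) := by
  have hpath := measurePreserving_path μ
  refine ⟨measurable_concat n, ?_⟩
  rw [← (hpath.prod hpath).map_eq,
    Measure.map_map (measurable_concat n) (hpath.prod hpath).measurable,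
    ← (hpath.comp (measurePreserving_splice μ n)).map_eq]
  exact congrArg (Measure.map · _) (funext fun p => (path_splice n p).symm)

theorem ae_restart_iterate_concat (n : ℕ) :
    ∀ᵐ p ∂(walk μ).prod (walk μ), restart^[n] (concat n p) = p.2 := by
  filter_upwards [Measure.quasiMeasurePreserving_fst.ae (ae_walk_zero μ),
    Measure.quasiMeasurePreserving_snd.ae (ae_walk_zero μ)] with p h₁ h₂
  exact restart_iterate_concat h₁ h₂

theorem measurePreserving_restart : MeasurePreserving restart (walk μ) (walk μ) := by
  refine ⟨measurable_restart, ?_⟩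
  conv_lhs => rw [← (measurePreserving_concat μ 1).map_eq]
  rw [Measure.map_map measurable_restart (measurable_concat 1),
    Measure.map_congr (show restart ∘ concat 1 =ᵐ[_] Prod.snd from ae_restart_iterate_concat μ 1)]
  exact measurePreserving_snd.map_eq

instance (n : ℕ) : IsProbabilityMeasure (posLaw μ n) :=
  Measure.isProbabilityMeasure_map (measurable_pi_apply n).aemeasurable

theorem posLaw_one : posLaw μ 1 = μ := by
  have h : (fun x : ℕ → G => x 1) ∘ (fun ω => path (1, ω)) = fun ω => ω 0 := by
    funext ω
    simp [path]
  rw [posLaw, walk_eq_map, Measure.map_map (measurable_pi_apply 1)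
    (measurePreserving_path μ).measurable, h]
  exact Measure.infinitePi_map_eval _ 0

theorem tsum_posLaw (n : ℕ) : ∑' g, posLaw μ n {g} = 1 := by
  simpa using (lintegral_countable' (μ := posLaw μ n) fun _ => 1).symm

theorem posLaw_mul_posLaw_le (m n : ℕ) (g h : G) :
    posLaw μ m {g} * posLaw μ n {h} ≤ posLaw μ (m + n) {g * h} := by
  have hmeas (k : ℕ) (a : G) : MeasurableSet ((fun x : ℕ → G => x k) ⁻¹' {a}) :=
    measurable_pi_apply k (measurableSet_singleton a)
  simp only [posLaw, Measure.map_apply (measurable_pi_apply _) (measurableSet_singleton _)]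
  rw [← (measurePreserving_concat μ m).measure_preimage (hmeas (m + n) (g * h)).nullMeasurableSet,
    ← Measure.prod_prod]
  refine measure_mono ?_
  rintro ⟨x, y⟩ ⟨rfl, rfl⟩
  exact concat_add m n (x, y)

end Walk

section BoundaryMap

variable {G : Type*} [Group G] [MeasurableSpace G] {μ : Measure G} [IsProbabilityMeasure μ]
  {X : Type*} [MeasurableSpace X] [MulAction G X] {β : (ℕ → G) → X}

/-- A measurable map from the path space to a `G`-space is a boundary map if it is almost surely
unchanged when the first step is forgotten, once the `G`-action has undone the translation in
`restart`. These are the projections from the path space to the `μ`-boundaries. -/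
structure IsBoundaryMap (μ : Measure G) [IsProbabilityMeasure μ] (β : (ℕ → G) → X) : Prop where
  measurable : Measurable β
  ae_eq_smul : ∀ᵐ x ∂walk μ, β x = x 1 • β (restart x)

theorem IsMuBoundary.isBoundaryMap_comp [Countable G] [MeasurableSingletonClass G]
    (hβ : IsBoundaryMap μ β) {Y : Type*} [MeasurableSpace Y] [MulAction G Y] {q : X → Y}
    (hq : IsMuBoundary μ β q) : IsBoundaryMap μ (q ∘ β) where
  measurable := hq.measurable.comp hβ.measurable
  ae_eq_smul := by
    have hequiv : ∀ᵐ x ∂walk μ, ∀ g : G, q (g • β x) = g • q (β x) :=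
      ae_all_iff.2 fun g => ae_of_ae_map hβ.measurable.aemeasurable (hq.equivariant g)
    filter_upwards [hβ.ae_eq_smul,
      (measurePreserving_restart μ).quasiMeasurePreserving.ae hequiv] with x hx hg
    rw [Function.comp_apply, hx, hg, Function.comp_apply]

theorem ae_walk_smul_of_ae_walkCount [Countable G] [MeasurableSingletonClass G]
    {p : (ℕ → G) → Prop} (hp : ∀ᵐ x ∂walkCount μ, p x) (g : G) : ∀ᵐ x ∂walk μ, p (g • x) := by
  have hg : pathMeasure μ (Measure.dirac g) = (walk μ).map (g • ·) := by
    rw [walk_eq_map, pathMeasure, Measure.dirac_prod, Measure.map_map measurable_path (by fun_prop),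
      Measure.map_map (measurable_const_smul g) (measurePreserving_path μ).measurable]
    congr 1
    funext ω n
    simp [path]
  have hac : pathMeasure μ (Measure.dirac g) ≪ walkCount μ :=
    ((Measure.AbsolutelyContinuous.mk fun s _ h => by
      simp [Measure.count_eq_zero_iff.1 h]).prod .rfl).map measurable_path
  exact ae_of_ae_map (measurable_const_smul g).aemeasurable (hg ▸ hac.ae_le hp)

namespace IsPoissonBoundary

variable [Countable G] [MeasurableSingletonClass G] {bnd : (ℕ → G) → X}

theorem ae_shift_eq [MeasurableSpace.CountablySeparated X] (hbnd : IsPoissonBoundary μ bnd) :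
    ∀ᵐ x ∂walk μ, bnd (shift x) = bnd x := by
  refine EventuallyEq.of_forall_separating_mem_iff MeasurableSet fun E hE => ?_
  obtain ⟨A, hA, hAE⟩ := hbnd.preimage_invariant E hE
  have hinv (x : ℕ → G) : shift x ∈ A ↔ x ∈ A :=
    Set.ext_iff.1 (MeasurableSpace.measurableSet_invariants.1 hA).2 x
  have hmem : ∀ᵐ x ∂walk μ, ∀ g : G, g • x ∈ A ↔ bnd (g • x) ∈ E :=
    ae_all_iff.2 (ae_walk_smul_of_ae_walkCount hAE.mem_iff)
  filter_upwards [hmem, (measurePreserving_restart μ).quasiMeasurePreserving.ae hmem] with x hx hsx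
  have h₁ := hx 1
  have h₂ := hsx (x 1)
  rw [one_smul] at h₁
  rw [smul_restart] at h₂
  rw [← h₂, hinv, h₁]

theorem isBoundaryMap [MeasurableSpace.CountablySeparated X] (hbnd : IsPoissonBoundary μ bnd) :
    IsBoundaryMap μ bnd where
  measurable := hbnd.measurable
  ae_eq_smul := by
    have hequiv : ∀ᵐ x ∂walk μ, ∀ g : G, bnd (g • x) = g • bnd x :=
      ae_all_iff.2 fun g => by simpa using ae_walk_smul_of_ae_walkCount (hbnd.equivariant g) 1
    filter_upwards [hbnd.ae_shift_eq,
      (measurePreserving_restart μ).quasiMeasurePreserving.ae hequiv] with x hx hg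
    rw [← hx, ← hg, smul_restart]

end IsPoissonBoundary

namespace IsBoundaryMap

theorem ae_comp (hβ : IsBoundaryMap μ β) {p : X → Prop} (hp : ∀ᵐ b ∂harmonicMeasure μ β, p b) :
    ∀ᵐ x ∂walk μ, p (β x) :=
  ae_of_ae_map hβ.measurable.aemeasurable hp

theorem harmonicMeasure_comp (hβ : IsBoundaryMap μ β) {Y : Type*} [MeasurableSpace Y] {q : X → Y}
    (hq : Measurable q) : harmonicMeasure μ (q ∘ β) = (harmonicMeasure μ β).map q :=
  (Measure.map_map hq hβ.measurable).symm

variable [Countable G] [MeasurableSingletonClass G]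

theorem ae_eq_smul_iterate (hβ : IsBoundaryMap μ β) (n : ℕ) :
    ∀ᵐ x ∂walk μ, β x = x n • β (restart^[n] x) := by
  induction n with
  | zero =>
    filter_upwards [ae_walk_zero μ] with x hx
    simp [hx]
  | succ n ih =>
    filter_upwards [hβ.ae_eq_smul, (measurePreserving_restart μ).quasiMeasurePreserving.ae ih]
      with x h₁ h₂
    rw [h₁, h₂, Function.iterate_succ_apply, ← mul_restart x n, mul_smul]

theorem ae_concat (hβ : IsBoundaryMap μ β) (n : ℕ) :
    ∀ᵐ p ∂(walk μ).prod (walk μ), β (concat n p) = p.1 n • β p.2 := by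
  filter_upwards [(measurePreserving_concat μ n).quasiMeasurePreserving.ae
      (hβ.ae_eq_smul_iterate n), ae_restart_iterate_concat μ n,
    Measure.quasiMeasurePreserving_snd.ae (ae_walk_zero μ)] with p h₁ h₂ h₃
  rw [h₁, h₂, concat_of_le h₃ le_rfl]

end IsBoundaryMap

end BoundaryMap

section TranslateDensity

open scoped ENNReal

variable {G : Type*} [Group G] {X : Type*} [MeasurableSpace X] [MulAction G X]

/-- The Radon-Nikodym derivative `d(g ν) / dν` of the translate of `ν` by `g`. -/
noncomputable def translateDensity (ν : Measure X) (g : G) : X → ℝ≥0∞ :=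
  (ν.map (g • ·)).rnDeriv ν

theorem measurable_translateDensity (ν : Measure X) (g : G) : Measurable (translateDensity ν g) :=
  Measure.measurable_rnDeriv _ _

theorem sigmaFinite_map_smul [MeasurableConstSMul G X] (ν : Measure X) [SigmaFinite ν] (g : G) :
    SigmaFinite (ν.map (g • ·)) :=
  (measurableEmbedding_const_smul g).sigmaFinite_map

theorem translateDensity_mul_smul [MeasurableConstSMul G X] (ν : Measure X) [SigmaFinite ν]
    {g : G} (hg : ν.map (g • ·) ≪ ν) (h : G) :
    ∀ᵐ b ∂ν, translateDensity ν (g * h) (g • b) =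
      translateDensity ν g (g • b) * translateDensity ν h b := by
  have hmeas : MeasurableEmbedding fun b : X => g • b := measurableEmbedding_const_smul g
  have hsf := sigmaFinite_map_smul ν (G := G)
  have hgh : ν.map ((g * h) • ·) = (ν.map (h • ·)).map (g • ·) := by
    rw [Measure.map_map (measurable_const_smul g) (measurable_const_smul h)]
    simp only [Function.comp_def, mul_smul]
  have : SigmaFinite ((ν.map (h • ·)).map (g • ·)) := hgh ▸ hsf (g * h)
  filter_upwards [hmeas.rnDeriv_map (ν.map (h • ·)) ν,
    ae_of_ae_map hmeas.measurable.aemeasurable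
      (Measure.rnDeriv_mul_rnDeriv' (μ := (ν.map (h • ·)).map (g • ·)) hg)] with b h₁ h₂
  simp only [translateDensity, hgh]
  rw [← h₁, mul_comm]
  exact h₂.symm

end TranslateDensity

namespace IsBoundaryMap

open scoped ENNReal

variable {G : Type*} [Group G] [MeasurableSpace G] [Countable G] [MeasurableSingletonClass G]
  {μ : Measure G} [IsProbabilityMeasure μ]
  {X : Type*} [MeasurableSpace X] [MulAction G X] {β : (ℕ → G) → X}

theorem isProbabilityMeasure_harmonicMeasure (hβ : IsBoundaryMap μ β) :
    IsProbabilityMeasure (harmonicMeasure μ β) :=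
  Measure.isProbabilityMeasure_map hβ.measurable.aemeasurable

theorem measurable_comp_eval {α : Type*} [MeasurableSpace α] (hβ : IsBoundaryMap μ β) (n : ℕ)
    {F : G → X → α} (hF : ∀ g, Measurable (F g)) : Measurable fun x => F (x n) (β x) :=
  (measurable_from_prod_countable_right (f := fun p : G × X => F p.1 p.2) hF).comp
    ((measurable_pi_apply n).prodMk hβ.measurable)

theorem ae_of_forall_ae_smul (hβ : IsBoundaryMap μ β) (n : ℕ) {p : G → X → Prop}
    (hp : ∀ g, posLaw μ n {g} ≠ 0 → ∀ᵐ b ∂harmonicMeasure μ β, p g (g • b)) :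
    ∀ᵐ x ∂walk μ, p (x n) (β x) := by
  have h : ∀ᵐ x ∂walk μ, ∀ g, posLaw μ n {g} ≠ 0 → p g (g • β x) :=
    ae_all_iff.2 fun g => by
      by_cases hg : posLaw μ n {g} = 0
      · simp [hg]
      · filter_upwards [hβ.ae_comp (hp g hg)] with x hx _ using hx
  filter_upwards [hβ.ae_eq_smul_iterate n, ae_posLaw_ne_zero μ n,
    ((measurePreserving_restart μ).iterate n).quasiMeasurePreserving.ae h] with x h₁ h₂ h₃
  rw [h₁]
  exact h₃ _ h₂

variable [MeasurableConstSMul G X]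

theorem map_restrict_eval (hβ : IsBoundaryMap μ β) (n : ℕ) (g : G) :
    ((walk μ).restrict ((fun x => x n) ⁻¹' {g})).map β =
      posLaw μ n {g} • (harmonicMeasure μ β).map (g • ·) := by
  ext s hs
  have hg : MeasurableSet ((fun x : ℕ → G => x n) ⁻¹' {g}) :=
    measurable_pi_apply n (measurableSet_singleton g)
  have hpre : concat n ⁻¹' (β ⁻¹' s ∩ (fun x => x n) ⁻¹' {g})
      =ᵐ[(walk μ).prod (walk μ)] ((fun x => x n) ⁻¹' {g}) ×ˢ (β ⁻¹' ((g • ·) ⁻¹' s)) := by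
    filter_upwards [hβ.ae_concat n, Measure.quasiMeasurePreserving_snd.ae (ae_walk_zero μ)]
      with p h₁ h₂
    refine propext ?_
    change β (concat n p) ∈ s ∧ concat n p n = g ↔ p.1 n = g ∧ g • β p.2 ∈ s
    rw [h₁, concat_of_le h₂ le_rfl, and_comm, and_congr_right_iff]
    rintro rfl
    rfl
  rw [Measure.map_apply hβ.measurable hs, Measure.restrict_apply (hβ.measurable hs),
    ← (measurePreserving_concat μ n).measure_preimage
      ((hβ.measurable hs).inter hg).nullMeasurableSet,
    measure_congr hpre, Measure.prod_prod, Measure.smul_apply, smul_eq_mul, posLaw,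
    Measure.map_apply (measurable_pi_apply n) (measurableSet_singleton g), harmonicMeasure,
    Measure.map_apply (measurable_const_smul g) hs,
    Measure.map_apply hβ.measurable (measurable_const_smul g hs)]

theorem lintegral_comp_eval (hβ : IsBoundaryMap μ β) (n : ℕ) {F : G → X → ℝ≥0∞}
    (hF : ∀ g, Measurable (F g)) :
    ∫⁻ x, F (x n) (β x) ∂walk μ =
      ∑' g, posLaw μ n {g} * ∫⁻ b, F g b ∂(harmonicMeasure μ β).map (g • ·) := by
  have hg (g : G) : MeasurableSet ((fun x : ℕ → G => x n) ⁻¹' {g}) :=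
    measurable_pi_apply n (measurableSet_singleton g)
  have hunion : ⋃ g, (fun x : ℕ → G => x n) ⁻¹' {g} = Set.univ := by
    rw [← Set.preimage_iUnion, Set.iUnion_of_singleton, Set.preimage_univ]
  rw [← setLIntegral_univ, ← hunion, lintegral_iUnion hg
    (fun g h hgh => (Set.disjoint_singleton.2 hgh).preimage _)]
  refine tsum_congr fun g => ?_
  rw [setLIntegral_congr_fun (hg g) (g := fun x => F g (β x)) fun x hx => congrArg (F · (β x)) hx,
    ← lintegral_map (hF g) hβ.measurable, hβ.map_restrict_eval, lintegral_smul_measure, smul_eq_mul]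

theorem map_smul_absolutelyContinuous (hβ : IsBoundaryMap μ β) {n : ℕ} {g : G}
    (hg : posLaw μ n {g} ≠ 0) : (harmonicMeasure μ β).map (g • ·) ≪ harmonicMeasure μ β := by
  have h := (Measure.absolutelyContinuous_of_le
    (Measure.restrict_le_self (μ := walk μ) (s := (fun x => x n) ⁻¹' {g}))).map hβ.measurable
  rw [hβ.map_restrict_eval] at h
  exact (Measure.absolutelyContinuous_smul hg).trans h

theorem ae_translateDensity_ne_zero (hβ : IsBoundaryMap μ β) (n : ℕ) :
    ∀ᵐ x ∂walk μ, translateDensity (harmonicMeasure μ β) (x n) (β x) ≠ 0 := by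
  have := hβ.isProbabilityMeasure_harmonicMeasure
  have := sigmaFinite_map_smul (G := G) (harmonicMeasure μ β)
  exact hβ.ae_of_forall_ae_smul n fun g hg =>
    ae_of_ae_map (measurable_const_smul g).aemeasurable
      ((Measure.rnDeriv_pos (hβ.map_smul_absolutelyContinuous hg)).mono fun _ => ne_of_gt)

theorem ae_translateDensity_ne_top (hβ : IsBoundaryMap μ β) (n : ℕ) :
    ∀ᵐ x ∂walk μ, translateDensity (harmonicMeasure μ β) (x n) (β x) ≠ ∞ := by
  have := hβ.isProbabilityMeasure_harmonicMeasure
  have := sigmaFinite_map_smul (G := G) (harmonicMeasure μ β)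
  filter_upwards [hβ.ae_comp (ae_all_iff.2 fun g : G =>
    Measure.rnDeriv_ne_top ((harmonicMeasure μ β).map (g • ·)) (harmonicMeasure μ β))] with x hx
  exact hx (x n)

theorem lintegral_div_translateDensity_le (hβ : IsBoundaryMap μ β) (n : ℕ) {w : G → X → ℝ≥0∞}
    (hw : ∀ g, Measurable (w g)) :
    ∫⁻ x, w (x n) (β x) / translateDensity (harmonicMeasure μ β) (x n) (β x) ∂walk μ ≤
      ∑' g, posLaw μ n {g} * ∫⁻ b, w g b ∂harmonicMeasure μ β := by
  have := hβ.isProbabilityMeasure_harmonicMeasure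
  have := sigmaFinite_map_smul (G := G) (harmonicMeasure μ β)
  have hquot (g : G) : Measurable fun b => w g b / translateDensity (harmonicMeasure μ β) g b :=
    (hw g).div (measurable_translateDensity _ g)
  rw [hβ.lintegral_comp_eval n hquot]
  refine ENNReal.tsum_le_tsum fun g => ?_
  by_cases hg : posLaw μ n {g} = 0
  · simp [hg]
  refine mul_le_mul_right ?_ _
  rw [← lintegral_rnDeriv_mul (hβ.map_smul_absolutelyContinuous hg) (hquot g).aemeasurable]
  exact lintegral_mono fun b => ENNReal.mul_div_le

end IsBoundaryMap

section LogDensity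

variable {G : Type*} [Group G] [MeasurableSpace G]
  {μ : Measure G} [IsProbabilityMeasure μ]
  {X : Type*} [MeasurableSpace X] [MulAction G X] {β : (ℕ → G) → X}

/-- The logarithm of the density of the translate of the harmonic measure by the position `x n`,
evaluated at the boundary point `β x`. Its expectation is `n` times the Furstenberg entropy. -/
noncomputable def logDensity (μ : Measure G) [IsProbabilityMeasure μ] (β : (ℕ → G) → X) (n : ℕ)
    (x : ℕ → G) : ℝ :=
  Real.log (translateDensity (harmonicMeasure μ β) (x n) (β x)).toReal

namespace IsBoundaryMap

variable [Countable G] [MeasurableSingletonClass G]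

theorem measurable_logDensity (hβ : IsBoundaryMap μ β) (n : ℕ) :
    Measurable (logDensity μ β n) :=
  (hβ.measurable_comp_eval n (measurable_translateDensity _)).ennreal_toReal.log

theorem logDensity_zero (hβ : IsBoundaryMap μ β) : logDensity μ β 0 =ᵐ[walk μ] 0 := by
  have := hβ.isProbabilityMeasure_harmonicMeasure
  have hone : ∀ᵐ b ∂harmonicMeasure μ β, translateDensity (harmonicMeasure μ β) (1 : G) b = 1 := by
    simp only [translateDensity, one_smul, Measure.map_id']
    exact Measure.rnDeriv_self _
  filter_upwards [ae_walk_zero μ, hβ.ae_comp hone] with x hx h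
  simp [logDensity, hx, h]

variable [MeasurableConstSMul G X]

theorem logDensity_succ (hβ : IsBoundaryMap μ β) (n : ℕ) :
    ∀ᵐ x ∂walk μ,
      logDensity μ β (n + 1) x = logDensity μ β 1 x + logDensity μ β n (restart x) := by
  have := hβ.isProbabilityMeasure_harmonicMeasure
  have hrestart := (measurePreserving_restart μ).quasiMeasurePreserving
  have hmul : ∀ᵐ b ∂harmonicMeasure μ β, ∀ g, posLaw μ 1 {g} ≠ 0 → ∀ h : G,
      translateDensity (harmonicMeasure μ β) (g * h) (g • b) =
        translateDensity (harmonicMeasure μ β) g (g • b) *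
          translateDensity (harmonicMeasure μ β) h b := by
    refine ae_all_iff.2 fun g => ?_
    by_cases hg : posLaw μ 1 {g} = 0
    · simp [hg]
    · filter_upwards [ae_all_iff.2
        (translateDensity_mul_smul _ (hβ.map_smul_absolutelyContinuous hg))] with b hb _ using hb
  filter_upwards [hβ.ae_eq_smul, ae_posLaw_ne_zero μ 1, hrestart.ae (hβ.ae_comp hmul),
    hβ.ae_translateDensity_ne_zero 1, hβ.ae_translateDensity_ne_top 1,
    hrestart.ae (hβ.ae_translateDensity_ne_zero n),
    hrestart.ae (hβ.ae_translateDensity_ne_top n)] with x hx hx₁ hmul h₁ h₁' h₂ h₂'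
  have h := hmul (x 1) hx₁ (restart x n)
  rw [← hx, mul_restart] at h
  rw [logDensity, h, ENNReal.toReal_mul, Real.log_mul (ENNReal.toReal_ne_zero.2 ⟨h₁, h₁'⟩)
    (ENNReal.toReal_ne_zero.2 ⟨h₂, h₂'⟩)]
  rfl

theorem logDensity_eq_birkhoffSum (hβ : IsBoundaryMap μ β) (n : ℕ) :
    logDensity μ β n =ᵐ[walk μ] birkhoffSum restart (logDensity μ β 1) n := by
  induction n with
  | zero => exact hβ.logDensity_zero
  | succ n ih =>
    filter_upwards [hβ.logDensity_succ n,
      (measurePreserving_restart μ).quasiMeasurePreserving.ae ih] with x h₁ h₂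
    rw [h₁, h₂, birkhoffSum_succ']

end IsBoundaryMap

end LogDensity

section Conditioning

open ProbabilityTheory

variable {Ω B : Type*} [MeasurableSpace Ω] [StandardBorelSpace Ω] [Nonempty Ω]
  [MeasurableSpace B] {ρ : Measure Ω} [IsFiniteMeasure ρ] {f : Ω → B}

theorem ae_ae_condDistrib_id [MeasurableEq B] (hf : Measurable f) {p : B → Ω → Prop}
    (hp : ∀ᵐ ω ∂ρ, p (f ω) ω) : ∀ᵐ b ∂ρ.map f, ∀ᵐ ω ∂condDistrib id f ρ b, p b ω := by
  obtain ⟨N, hN, hN_meas, hN_null⟩ := exists_measurable_superset_of_null (ae_iff.1 hp)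
  have hgraph : MeasurableSet {z : B × Ω | z.2 ∉ N ∧ z.1 = f z.2} :=
    (measurable_snd hN_meas.compl).inter
      (measurableSet_eq_fun measurable_fst (hf.comp measurable_snd))
  have hjoint : ∀ᵐ z ∂ρ.map (fun ω => (f ω, id ω)), z.2 ∉ N ∧ z.1 = f z.2 := by
    rw [ae_map_iff (hf.prodMk measurable_id).aemeasurable hgraph]
    filter_upwards [measure_eq_zero_iff_ae_notMem.1 hN_null] with ω hω using ⟨hω, rfl⟩
  rw [← compProd_map_condDistrib aemeasurable_id] at hjoint
  filter_upwards [Measure.ae_ae_of_ae_compProd hjoint] with b hb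
  filter_upwards [hb] with ω ⟨hωN, hbω⟩
  by_contra hnot
  exact hωN (hN fun h => hnot (by rwa [show b = f ω from hbω]))

theorem lintegral_condDistrib_id_prodMk (hf : Measurable f) {S : Set (B × Ω)}
    (hS : MeasurableSet S) :
    ∫⁻ b, condDistrib id f ρ b (Prod.mk b ⁻¹' S) ∂ρ.map f = ρ {ω | (f ω, ω) ∈ S} := by
  rw [← Measure.compProd_apply hS, compProd_map_condDistrib aemeasurable_id,
    Measure.map_apply (hf.prodMk measurable_id) hS]
  rfl

theorem tendsto_measure_of_ae_tendsto_condDistrib_id (hf : Measurable f) {S : ℕ → Set (B × Ω)}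
    (hS : ∀ n, MeasurableSet (S n))
    (h : ∀ᵐ b ∂ρ.map f,
      Tendsto (fun n => condDistrib id f ρ b (Prod.mk b ⁻¹' S n)) atTop (𝓝 0)) :
    Tendsto (fun n => ρ {ω | (f ω, ω) ∈ S n}) atTop (𝓝 0) := by
  have hlim := tendsto_lintegral_of_dominated_convergence (fun _ => 1)
    (fun n => Kernel.measurable_kernel_prodMk_left (hS n))
    (fun n => ae_of_all _ fun b => prob_le_one) (by simp) h
  simpa only [lintegral_condDistrib_id_prodMk hf (hS _), lintegral_zero] using hlim

end Conditioning

section PositionInformation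

variable {G : Type*} [Group G] [MeasurableSpace G] (μ : Measure G) [IsProbabilityMeasure μ]

/-- The information content of the position of the random walk at time `n`, whose expectation is
the entropy of the `n`-fold convolution power of `μ`. -/
noncomputable def posInfo (n : ℕ) : (ℕ → G) → ℝ :=
  info (walk μ) fun x => x n

variable [MeasurableSingletonClass G]

theorem posInfo_eq_neg_log (n : ℕ) (x : ℕ → G) :
    posInfo μ n x = -Real.log ((posLaw μ n).real {x n}) := by
  rw [posInfo, info, posLaw, map_measureReal_apply (measurable_pi_apply n)
    (measurableSet_singleton _)]

variable [Countable G]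

theorem posLaw_real_pos (n : ℕ) : ∀ᵐ x ∂walk μ, 0 < (posLaw μ n).real {x n} :=
  (ae_posLaw_ne_zero μ n).mono fun _ hx => ENNReal.toReal_pos hx (measure_ne_top _ _)

theorem posInfo_zero : posInfo μ 0 =ᵐ[walk μ] 0 := by
  have hone : (walk μ).real ((fun x => x 0) ⁻¹' {1}) = 1 :=
    (ENNReal.toReal_eq_one_iff _).2 (mem_ae_iff_prob_eq_one
      (measurable_pi_apply 0 (measurableSet_singleton 1)) |>.1 (ae_walk_zero μ))
  filter_upwards [ae_walk_zero μ] with x hx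
  rw [posInfo, info, hx, hone, Real.log_one, neg_zero, Pi.zero_apply]

theorem posInfo_succ_le (n : ℕ) :
    ∀ᵐ x ∂walk μ, posInfo μ (n + 1) x ≤ posInfo μ 1 x + posInfo μ n (restart x) := by
  filter_upwards [posLaw_real_pos μ 1,
    (measurePreserving_restart μ).quasiMeasurePreserving.ae (posLaw_real_pos μ n)] with x h₁ h₂
  have hle : (posLaw μ 1).real {x 1} * (posLaw μ n).real {restart x n} ≤
      (posLaw μ (n + 1)).real {x (n + 1)} := by
    simp only [measureReal_def]
    rw [← ENNReal.toReal_mul, ← mul_restart x n, add_comm n]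
    exact ENNReal.toReal_mono (measure_ne_top _ _) (posLaw_mul_posLaw_le μ 1 n _ _)
  have hlog := Real.log_le_log (mul_pos h₁ h₂) hle
  rw [Real.log_mul h₁.ne' h₂.ne'] at hlog
  simp only [posInfo_eq_neg_log]
  linarith

theorem posInfo_le_birkhoffSum (n : ℕ) :
    posInfo μ n ≤ᵐ[walk μ] birkhoffSum restart (posInfo μ 1) n :=
  ae_le_birkhoffSum (measurePreserving_restart μ).quasiMeasurePreserving (posInfo_zero μ).le
    (posInfo_succ_le μ) n

variable {μ} in
theorem FiniteEntropy.integrable_posInfo_one (hμ : FiniteEntropy μ) :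
    Integrable (posInfo μ 1) (walk μ) := by
  have hmp : MeasurePreserving (fun x => x 1) (walk μ) μ := by
    simpa only [posLaw_one] using measurePreserving_eval μ 1
  have hinfo : posInfo μ 1 = (fun g => -Real.log (μ.real {g})) ∘ fun x => x 1 := by
    funext x
    rw [posInfo_eq_neg_log, posLaw_one, Function.comp_apply]
  have hterm (g : G) : ‖-Real.log (μ.real {g})‖ₑ * μ {g} =
      ENNReal.ofReal (Real.negMulLog (μ.real {g})) := by
    have hnonneg : 0 ≤ -Real.log (μ.real {g}) :=
      neg_nonneg.2 (Real.log_nonpos measureReal_nonneg measureReal_le_one)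
    rw [Real.enorm_of_nonneg hnonneg, ← ofReal_measureReal (μ := μ) (s := {g}),
      ← ENNReal.ofReal_mul hnonneg, Real.negMulLog, neg_mul_comm, mul_comm]
  rw [hinfo]
  refine hmp.integrable_comp_of_integrable ⟨(measurable_of_countable _).aestronglyMeasurable, ?_⟩
  rw [hasFiniteIntegral_iff_enorm, lintegral_countable']
  simp only [hterm]
  exact hμ.tsum_ofReal_lt_top

end PositionInformation

section ConditionalInformation

open scoped ENNReal

variable {G : Type*} [Group G] [MeasurableSpace G] [Countable G] [MeasurableSingletonClass G]
  {X : Type*} [MeasurableSpace X]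

/-- The conditional law of the random walk given the boundary point `β x`. -/
noncomputable def condWalk (μ : Measure G) [IsProbabilityMeasure μ] (β : (ℕ → G) → X) :
    ProbabilityTheory.Kernel X (ℕ → G) :=
  ProbabilityTheory.condDistrib id β (walk μ)

/-- The conditional information content of the position at time `n` given the boundary point
`β x`. -/
noncomputable def condInfo (μ : Measure G) [IsProbabilityMeasure μ] (β : (ℕ → G) → X) (n : ℕ)
    (x : ℕ → G) : ℝ :=
  info (condWalk μ β (β x)) (fun y => y n) x

instance (μ : Measure G) [IsProbabilityMeasure μ] (β : (ℕ → G) → X) :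
    ProbabilityTheory.IsMarkovKernel (condWalk μ β) :=
  inferInstanceAs (ProbabilityTheory.IsMarkovKernel (ProbabilityTheory.condDistrib id β (walk μ)))

variable {μ : Measure G} [IsProbabilityMeasure μ] {β : (ℕ → G) → X}

theorem measurable_info_condWalk (n : ℕ) :
    Measurable fun p : X × (ℕ → G) => info (condWalk μ β p.1) (fun y => y n) p.2 := by
  let F (p : G × X) : ℝ := -Real.log ((condWalk μ β p.2).real ((fun y => y n) ⁻¹' {p.1}))
  have hF : Measurable F := measurable_from_prod_countable_right fun g =>
    ((condWalk μ β).measurable_coe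
      (measurable_pi_apply n (measurableSet_singleton g))).ennreal_toReal.log.neg
  exact hF.comp (f := fun p : X × (ℕ → G) => (p.2 n, p.1))
    (((measurable_pi_apply n).comp measurable_snd).prodMk measurable_fst)

namespace IsBoundaryMap

variable [MulAction G X]

theorem measurable_condInfo (hβ : IsBoundaryMap μ β) (n : ℕ) : Measurable (condInfo μ β n) :=
  (measurable_info_condWalk n).comp (hβ.measurable.prodMk measurable_id)

theorem tendsto_measure_lt_condInfo_of_gauge [MeasurableEq X] (hβ : IsBoundaryMap μ β)
    {𝒢 : X → ℕ → Gauge G} (h𝒢 : ∀ᵐ b ∂harmonicMeasure μ β, UniformlyTemperate (𝒢 b))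
    (hlim : ∀ᵐ x ∂walk μ,
      Tendsto (fun n : ℕ => 1 / (n : ℝ) * ((𝒢 (β x) n).norm (x n) : ℝ)) atTop (𝓝 0))
    {δ : ℝ} (hδ : 0 < δ) :
    Tendsto (fun n : ℕ => walk μ {x | δ * n < condInfo μ β n x}) atTop (𝓝 0) := by
  refine tendsto_measure_of_ae_tendsto_condDistrib_id hβ.measurable
    (S := fun n => {p | δ * n < info (condWalk μ β p.1) (fun y => y n) p.2})
    (fun n => measurableSet_lt measurable_const (measurable_info_condWalk n)) ?_
  filter_upwards [h𝒢, ae_ae_condDistrib_id hβ.measurable (p := fun b x =>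
    Tendsto (fun n : ℕ => 1 / (n : ℝ) * ((𝒢 b n).norm (x n) : ℝ)) atTop (𝓝 0)) hlim]
    with b h𝒢b hlimb
  exact tendsto_measure_lt_info_of_gauge (condWalk μ β b) measurable_pi_apply h𝒢b hlimb hδ

variable [MeasurableConstSMul G X]

theorem condWalk_preimage_eval (hβ : IsBoundaryMap μ β) :
    ∀ᵐ b ∂harmonicMeasure μ β, ∀ n g, condWalk μ β b ((fun x => x n) ⁻¹' {g}) =
      posLaw μ n {g} * translateDensity (harmonicMeasure μ β) g b := by
  have := hβ.isProbabilityMeasure_harmonicMeasure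
  have := sigmaFinite_map_smul (G := G) (harmonicMeasure μ β)
  refine ae_all_iff.2 fun n => ae_all_iff.2 fun g => ?_
  have hg : MeasurableSet ((fun x : ℕ → G => x n) ⁻¹' {g}) :=
    measurable_pi_apply n (measurableSet_singleton g)
  have hκ := (condWalk μ β).measurable_coe hg
  refine ae_eq_of_forall_setLIntegral_eq_of_sigmaFinite hκ
    ((measurable_translateDensity _ g).const_mul _) fun s hs _ => ?_
  have hjoint : walk μ (β ⁻¹' s ∩ (fun x => x n) ⁻¹' {g}) =
      posLaw μ n {g} * (harmonicMeasure μ β).map (g • ·) s := by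
    rw [← Measure.restrict_apply (hβ.measurable hs), ← Measure.map_apply hβ.measurable hs,
      hβ.map_restrict_eval, Measure.smul_apply, smul_eq_mul]
  rw [harmonicMeasure, setLIntegral_map hs hκ hβ.measurable, condWalk,
    ProbabilityTheory.setLIntegral_preimage_condDistrib hβ.measurable aemeasurable_id hg hs,
    Set.preimage_id, hjoint, lintegral_const_mul _ (measurable_translateDensity _ g)]
  by_cases h₀ : posLaw μ n {g} = 0
  · simp [h₀]
  · rw [← Measure.setLIntegral_rnDeriv (hβ.map_smul_absolutelyContinuous h₀)]
    rfl

theorem condInfo_eq_sub (hβ : IsBoundaryMap μ β) (n : ℕ) :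
    condInfo μ β n =ᵐ[walk μ] posInfo μ n - logDensity μ β n := by
  filter_upwards [hβ.ae_comp hβ.condWalk_preimage_eval, posLaw_real_pos μ n,
    hβ.ae_translateDensity_ne_zero n, hβ.ae_translateDensity_ne_top n] with x hx h₁ h₂ h₃
  rw [condInfo, info, measureReal_def, hx, ENNReal.toReal_mul,
    ← measureReal_def, Real.log_mul h₁.ne' (ENNReal.toReal_pos h₂ h₃).ne', neg_add', Pi.sub_apply,
    posInfo_eq_neg_log]
  rfl

theorem logDensity_le_posInfo (hβ : IsBoundaryMap μ β) (n : ℕ) :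
    logDensity μ β n ≤ᵐ[walk μ] posInfo μ n := by
  filter_upwards [hβ.condInfo_eq_sub n] with x hx
  exact sub_nonneg.1 ((info_nonneg _ _ _).trans_eq hx)

theorem integrable_inv_translateDensity (hβ : IsBoundaryMap μ β) (n : ℕ) :
    Integrable (fun x => (translateDensity (harmonicMeasure μ β) (x n) (β x)).toReal⁻¹)
      (walk μ) := by
  have := hβ.isProbabilityMeasure_harmonicMeasure
  have hle : ∫⁻ x, (translateDensity (harmonicMeasure μ β) (x n) (β x))⁻¹ ∂walk μ ≤ 1 := by
    have h := hβ.lintegral_div_translateDensity_le n (w := fun _ _ => 1) fun _ => measurable_const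
    simpa only [one_div, lintegral_one, measure_univ, mul_one, tsum_posLaw] using h
  simp only [← ENNReal.toReal_inv]
  exact integrable_toReal_of_lintegral_ne_top
    (hβ.measurable_comp_eval n fun g => (measurable_translateDensity _ g).inv).aemeasurable
    (ne_top_of_le_ne_top ENNReal.one_ne_top hle)

theorem integrable_logDensity_one (hβ : IsBoundaryMap μ β) (hμ : FiniteEntropy μ) :
    Integrable (logDensity μ β 1) (walk μ) := by
  refine (hμ.integrable_posInfo_one.add (hβ.integrable_inv_translateDensity 1)).mono'
    (hβ.measurable_logDensity 1).aestronglyMeasurable ?_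
  filter_upwards [hβ.logDensity_le_posInfo 1, hβ.ae_translateDensity_ne_zero 1,
    hβ.ae_translateDensity_ne_top 1] with x hx h₀ h_top
  have hinv := inv_pos.2 (ENNReal.toReal_pos h₀ h_top)
  have hlog := Real.log_le_sub_one_of_pos hinv
  rw [Real.log_inv] at hlog
  have hinfo : 0 ≤ posInfo μ 1 x := info_nonneg _ _ _
  rw [Real.norm_eq_abs, abs_le, Pi.add_apply]
  unfold logDensity at hx ⊢
  constructor <;> linarith

theorem integrable_logDensity (hβ : IsBoundaryMap μ β) (hμ : FiniteEntropy μ) (n : ℕ) :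
    Integrable (logDensity μ β n) (walk μ) :=
  (integrable_birkhoffSum (measurePreserving_restart μ) (hβ.integrable_logDensity_one hμ) n).congr
    (hβ.logDensity_eq_birkhoffSum n).symm

theorem integral_logDensity (hβ : IsBoundaryMap μ β) (hμ : FiniteEntropy μ) (n : ℕ) :
    ∫ x, logDensity μ β n x ∂walk μ = n * ∫ x, logDensity μ β 1 x ∂walk μ :=
  (integral_congr_ae (hβ.logDensity_eq_birkhoffSum n)).trans
    (integral_birkhoffSum (measurePreserving_restart μ) (hβ.integrable_logDensity_one hμ) n)

theorem condInfo_le_birkhoffSum (hβ : IsBoundaryMap μ β) (n : ℕ) :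
    condInfo μ β n ≤ᵐ[walk μ] birkhoffSum restart (posInfo μ 1 - logDensity μ β 1) n := by
  filter_upwards [hβ.condInfo_eq_sub n, posInfo_le_birkhoffSum μ n,
    hβ.logDensity_eq_birkhoffSum n] with x h₁ h₂ h₃
  rw [h₁, birkhoffSum_sub, Pi.sub_apply, h₃]
  exact sub_le_sub_right h₂ _

theorem integrable_condInfo (hβ : IsBoundaryMap μ β) (hμ : FiniteEntropy μ) (n : ℕ) :
    Integrable (condInfo μ β n) (walk μ) := by
  refine (integrable_birkhoffSum (measurePreserving_restart μ)
    (hμ.integrable_posInfo_one.sub (hβ.integrable_logDensity_one hμ)) n).mono'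
    (hβ.measurable_condInfo n).aestronglyMeasurable ?_
  filter_upwards [hβ.condInfo_le_birkhoffSum n] with x hx
  exact (Real.norm_of_nonneg (info_nonneg _ _ _)).trans_le hx

theorem tendsto_integral_condInfo_div_of_gauge [MeasurableEq X] (hβ : IsBoundaryMap μ β)
    (hμ : FiniteEntropy μ) {𝒢 : X → ℕ → Gauge G}
    (h𝒢 : ∀ᵐ b ∂harmonicMeasure μ β, UniformlyTemperate (𝒢 b))
    (hlim : ∀ᵐ x ∂walk μ,
      Tendsto (fun n : ℕ => 1 / (n : ℝ) * ((𝒢 (β x) n).norm (x n) : ℝ)) atTop (𝓝 0)) :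
    Tendsto (fun n : ℕ => (∫ x, condInfo μ β n x ∂walk μ) / n) atTop (𝓝 0) :=
  tendsto_integral_div_of_le_birkhoffSum (measurePreserving_restart μ)
    (hμ.integrable_posInfo_one.sub (hβ.integrable_logDensity_one hμ)) hβ.measurable_condInfo
    (fun _ => ae_of_all _ fun _ => info_nonneg _ _ _) hβ.condInfo_le_birkhoffSum
    fun _ => hβ.tendsto_measure_lt_condInfo_of_gauge h𝒢 hlim

end IsBoundaryMap

end ConditionalInformation

section Rigidity

open scoped ENNReal

variable {G : Type*} [Group G] [MeasurableSpace G] [Countable G] [MeasurableSingletonClass G]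
  {μ : Measure G} [IsProbabilityMeasure μ]
  {X : Type*} [MeasurableSpace X] [MulAction G X]
  {Y : Type*} [MeasurableSpace Y] [MulAction G Y]
  {β : (ℕ → G) → X} {q : X → Y}

namespace IsBoundaryMap

theorem lintegral_translateDensity_comp_le_one (hβ : IsBoundaryMap μ β) (hq : Measurable q)
    [MeasurableConstSMul G Y] (g : G) :
    ∫⁻ b, translateDensity (harmonicMeasure μ (q ∘ β)) g (q b) ∂harmonicMeasure μ β ≤ 1 := by
  have := hβ.isProbabilityMeasure_harmonicMeasure
  rw [← lintegral_map (measurable_translateDensity _ g) hq, hβ.harmonicMeasure_comp hq]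
  have := Measure.isProbabilityMeasure_map (μ := harmonicMeasure μ β) hq.aemeasurable
  refine Measure.lintegral_rnDeriv_le.trans ?_
  rw [Measure.map_apply (measurable_const_smul g) .univ]
  exact prob_le_one

variable [MeasurableConstSMul G X]

theorem ae_map_smul_of_ae_comp_eval (hβ : IsBoundaryMap μ β) {n : ℕ} {p : G → X → Prop}
    (hp : ∀ᵐ x ∂walk μ, p (x n) (β x)) {g : G} (hp_meas : MeasurableSet {b | p g b})
    (hg : posLaw μ n {g} ≠ 0) : ∀ᵐ b ∂(harmonicMeasure μ β).map (g • ·), p g b := by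
  rw [← Measure.ae_ennreal_smul_measure_iff hg, ← hβ.map_restrict_eval,
    ae_map_iff hβ.measurable.aemeasurable hp_meas,
    ae_restrict_iff' (measurable_pi_apply n (measurableSet_singleton g))]
  filter_upwards [hp] with x hx hxg
  exact (show x n = g from hxg) ▸ hx

variable [MeasurableConstSMul G Y]

theorem integral_logDensity_one_le_of_gauge [MeasurableEq Y] (hβ : IsBoundaryMap μ β)
    (hμ : FiniteEntropy μ) (hqβ : IsBoundaryMap μ (q ∘ β)) {𝒢 : Y → ℕ → Gauge G}
    (h𝒢 : ∀ᵐ b ∂harmonicMeasure μ (q ∘ β), UniformlyTemperate (𝒢 b))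
    (hlim : ∀ᵐ x ∂walk μ,
      Tendsto (fun n : ℕ => 1 / (n : ℝ) * ((𝒢 (q (β x)) n).norm (x n) : ℝ)) atTop (𝓝 0)) :
    ∫ x, logDensity μ β 1 x ∂walk μ ≤ ∫ x, logDensity μ (q ∘ β) 1 x ∂walk μ := by
  have hle (n : ℕ) : ∫ x, logDensity μ β n x ∂walk μ ≤
      ∫ x, condInfo μ (q ∘ β) n x ∂walk μ + ∫ x, logDensity μ (q ∘ β) n x ∂walk μ := by
    rw [← integral_add (hqβ.integrable_condInfo hμ n) (hqβ.integrable_logDensity hμ n)]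
    refine integral_mono_ae (hβ.integrable_logDensity hμ n)
      ((hqβ.integrable_condInfo hμ n).add (hqβ.integrable_logDensity hμ n)) ?_
    filter_upwards [hβ.logDensity_le_posInfo n, hqβ.condInfo_eq_sub n] with x h₁ h₂
    rwa [h₂, Pi.sub_apply, sub_add_cancel]
  refine sub_nonpos.1 (ge_of_tendsto (hqβ.tendsto_integral_condInfo_div_of_gauge hμ h𝒢 hlim) ?_)
  filter_upwards [eventually_gt_atTop 0] with n hn
  have h := hle n
  rw [hβ.integral_logDensity hμ, hqβ.integral_logDensity hμ] at h
  rw [le_div_iff₀ (Nat.cast_pos.2 hn)]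
  linarith

theorem lintegral_translateDensity_comp_div_le_one (hβ : IsBoundaryMap μ β) (hq : Measurable q)
    (n : ℕ) :
    ∫⁻ x, translateDensity (harmonicMeasure μ (q ∘ β)) (x n) (q (β x)) /
      translateDensity (harmonicMeasure μ β) (x n) (β x) ∂walk μ ≤ 1 := by
  refine (hβ.lintegral_div_translateDensity_le n
    (w := fun g b => translateDensity (harmonicMeasure μ (q ∘ β)) g (q b))
    fun g => (measurable_translateDensity _ g).comp hq).trans ?_
  rw [← tsum_posLaw μ n]
  exact ENNReal.tsum_le_tsum fun g =>
    mul_le_of_le_one_right' (hβ.lintegral_translateDensity_comp_le_one hq g)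

theorem logDensity_one_ae_eq_comp (hβ : IsBoundaryMap μ β) (hμ : FiniteEntropy μ)
    (hq : Measurable q) (hqβ : IsBoundaryMap μ (q ∘ β))
    (hle : ∫ x, logDensity μ β 1 x ∂walk μ ≤ ∫ x, logDensity μ (q ∘ β) 1 x ∂walk μ) :
    logDensity μ β 1 =ᵐ[walk μ] logDensity μ (q ∘ β) 1 := by
  let R (x : ℕ → G) : ℝ≥0∞ := translateDensity (harmonicMeasure μ (q ∘ β)) (x 1) (q (β x)) /
    translateDensity (harmonicMeasure μ β) (x 1) (β x)
  have hR_meas : AEMeasurable R (walk μ) := (hβ.measurable_comp_eval 1 fun g =>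
    ((measurable_translateDensity (harmonicMeasure μ (q ∘ β)) g).comp hq).div
      (measurable_translateDensity (harmonicMeasure μ β) g)).aemeasurable
  have hR_le : ∫⁻ x, R x ∂walk μ ≤ 1 := hβ.lintegral_translateDensity_comp_div_le_one hq 1
  have hR_fin : ∫⁻ x, R x ∂walk μ ≠ ∞ := ne_top_of_le_ne_top ENNReal.one_ne_top hR_le
  have hlog : ∀ᵐ x ∂walk μ, 0 < (R x).toReal ∧
      Real.log (R x).toReal = logDensity μ (q ∘ β) 1 x - logDensity μ β 1 x := by
    filter_upwards [hβ.ae_translateDensity_ne_zero 1, hβ.ae_translateDensity_ne_top 1,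
      hqβ.ae_translateDensity_ne_zero 1, hqβ.ae_translateDensity_ne_top 1] with x h₁ h₂ h₃ h₄
    have hD := ENNReal.toReal_pos h₁ h₂
    have hDq := ENNReal.toReal_pos h₃ h₄
    simp only [R, ENNReal.toReal_div, logDensity]
    exact ⟨div_pos hDq hD, Real.log_div hDq.ne' hD.ne'⟩
  have hlog_eq : (fun x => Real.log (R x).toReal) =ᵐ[walk μ]
      fun x => logDensity μ (q ∘ β) 1 x - logDensity μ β 1 x := hlog.mono fun _ h => h.2
  have hint := hβ.integrable_logDensity_one hμ
  have hint_q := hqβ.integrable_logDensity_one hμ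
  have hR_one := ae_eq_one_of_integral_log_nonneg (hlog.mono fun _ h => h.1)
    (integrable_toReal_of_lintegral_ne_top hR_meas hR_fin)
    ((hint_q.sub hint).congr hlog_eq.symm)
    (by
      rw [integral_toReal hR_meas (ae_lt_top' hR_meas hR_fin)]
      exact ENNReal.toReal_le_of_le_ofReal zero_le_one (by simpa using hR_le))
    (by
      rw [integral_congr_ae hlog_eq, integral_sub hint_q hint]
      exact sub_nonneg.2 hle)
  filter_upwards [hR_one, hlog_eq] with x h₁ h₂
  rw [h₁, Pi.one_apply, Real.log_one] at h₂
  exact (sub_eq_zero.1 h₂.symm).symm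

theorem logDensity_ae_eq_comp (hβ : IsBoundaryMap μ β) (hqβ : IsBoundaryMap μ (q ∘ β))
    (h : logDensity μ β 1 =ᵐ[walk μ] logDensity μ (q ∘ β) 1) (n : ℕ) :
    logDensity μ β n =ᵐ[walk μ] logDensity μ (q ∘ β) n := by
  have hiter : ∀ᵐ x ∂walk μ, ∀ i,
      logDensity μ β 1 (restart^[i] x) = logDensity μ (q ∘ β) 1 (restart^[i] x) :=
    ae_all_iff.2 fun i => ((measurePreserving_restart μ).iterate i).quasiMeasurePreserving.ae h
  filter_upwards [hβ.logDensity_eq_birkhoffSum n, hqβ.logDensity_eq_birkhoffSum n, hiter]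
    with x h₁ h₂ hx
  rw [h₁, h₂]
  exact Finset.sum_congr rfl fun i _ => hx i

theorem translateDensity_eval_ae_eq_comp (hβ : IsBoundaryMap μ β)
    (hqβ : IsBoundaryMap μ (q ∘ β)) {n : ℕ}
    (h : logDensity μ β n =ᵐ[walk μ] logDensity μ (q ∘ β) n) :
    ∀ᵐ x ∂walk μ, translateDensity (harmonicMeasure μ β) (x n) (β x) =
      translateDensity (harmonicMeasure μ (q ∘ β)) (x n) (q (β x)) := by
  filter_upwards [h, hβ.ae_translateDensity_ne_zero n, hβ.ae_translateDensity_ne_top n,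
    hqβ.ae_translateDensity_ne_zero n, hqβ.ae_translateDensity_ne_top n] with x hx h₁ h₂ h₃ h₄
  exact (ENNReal.toReal_eq_toReal_iff' h₂ h₄).1
    (Real.log_injOn_pos (ENNReal.toReal_pos h₁ h₂) (ENNReal.toReal_pos h₃ h₄) hx)

theorem translateDensity_ae_eq_comp (hβ : IsBoundaryMap μ β) (hq : Measurable q)
    (hqβ : IsBoundaryMap μ (q ∘ β)) {n : ℕ}
    (h : logDensity μ β n =ᵐ[walk μ] logDensity μ (q ∘ β) n) {g : G} (hg : posLaw μ n {g} ≠ 0) :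
    translateDensity (harmonicMeasure μ β) g =ᵐ[harmonicMeasure μ β]
      fun b => translateDensity (harmonicMeasure μ (q ∘ β)) g (q b) := by
  have := hβ.isProbabilityMeasure_harmonicMeasure
  have := sigmaFinite_map_smul (G := G) (harmonicMeasure μ β)
  have hac := hβ.map_smul_absolutelyContinuous hg
  have hD := measurable_translateDensity (harmonicMeasure μ β) (G := G)
  have hDq (g : G) : Measurable fun b => translateDensity (harmonicMeasure μ (q ∘ β)) g (q b) :=
    (measurable_translateDensity _ g).comp hq
  have hsupp := hβ.ae_map_smul_of_ae_comp_eval (p := fun g b => translateDensity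
    (harmonicMeasure μ β) g b = translateDensity (harmonicMeasure μ (q ∘ β)) g (q b))
    (hβ.translateDensity_eval_ae_eq_comp hqβ h) (measurableSet_eq_fun (hD g) (hDq g)) hg
  rw [← Measure.withDensity_rnDeriv_eq _ _ hac,
    ae_withDensity_iff (Measure.measurable_rnDeriv _ _)] at hsupp
  have hle : translateDensity (harmonicMeasure μ β) g ≤ᵐ[harmonicMeasure μ β]
      fun b => translateDensity (harmonicMeasure μ (q ∘ β)) g (q b) := by
    filter_upwards [hsupp] with b hb
    by_cases h₀ : translateDensity (harmonicMeasure μ β) g b = 0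
    · exact h₀ ▸ zero_le
    · exact (hb h₀).le
  have hone : ∫⁻ b, translateDensity (harmonicMeasure μ β) g b ∂harmonicMeasure μ β = 1 := by
    rw [show translateDensity (harmonicMeasure μ β) g = Measure.rnDeriv _ _ from rfl,
      Measure.lintegral_rnDeriv hac, Measure.map_apply (measurable_const_smul g) .univ,
      Set.preimage_univ, measure_univ]
  exact ae_eq_of_ae_le_of_lintegral_le hle (hone ▸ ENNReal.one_ne_top) (hDq g).aemeasurable
    ((hβ.lintegral_translateDensity_comp_le_one hq g).trans hone.ge)

end IsBoundaryMap

end Rigidity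

section Maximality

variable {G : Type*} [Group G] [MeasurableSpace G] {μ : Measure G} [IsProbabilityMeasure μ]
  {X : Type*} [MeasurableSpace X] [MulAction G X] {β : (ℕ → G) → X}

namespace IsBoundaryMap

theorem integral_map_smul_harmonicMeasure [MeasurableConstSMul G X] (hβ : IsBoundaryMap μ β)
    {f : X → ℝ} (hf : Measurable f) (g : G) :
    ∫ b, f b ∂(harmonicMeasure μ β).map (g • ·) = ∫ y, f (g • β y) ∂walk μ := by
  have hg : Measurable fun b : X => g • b := measurable_const_smul g
  rw [harmonicMeasure, Measure.map_map hg hβ.measurable,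
    integral_map (hg.comp hβ.measurable).aemeasurable hf.aestronglyMeasurable]
  rfl

variable [Countable G] [MeasurableSingletonClass G]

theorem setIntegral_comp_eq_setIntegral_integral_smul (hβ : IsBoundaryMap μ β) {f : X → ℝ}
    (hf_int : Integrable f (harmonicMeasure μ β)) {n : ℕ} {A : Set (ℕ → G)}
    (hA : MeasurableSet A) (hconcat : ∀ p, concat n p ∈ A ↔ p.1 ∈ A) :
    ∫ x in A, f (β x) ∂walk μ = ∫ x in A, ∫ y, f (x n • β y) ∂walk μ ∂walk μ := by
  have hmp := measurePreserving_concat μ n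
  have hind : Integrable (A.indicator fun x => f (β x)) (walk μ) :=
    (hf_int.comp_measurable hβ.measurable).indicator hA
  have hsplit : (fun p => A.indicator (fun x => f (β x)) (concat n p))
      =ᵐ[(walk μ).prod (walk μ)] fun p => A.indicator (fun x => f (x n • β p.2)) p.1 := by
    filter_upwards [hβ.ae_concat n] with p hp
    by_cases hpA : p.1 ∈ A
    · rw [Set.indicator_of_mem hpA, Set.indicator_of_mem ((hconcat p).2 hpA), hp]
    · rw [Set.indicator_of_notMem hpA, Set.indicator_of_notMem (mt (hconcat p).1 hpA)]
  rw [← integral_indicator hA, ← integral_indicator hA, ← hmp.map_eq,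
    integral_map hmp.aemeasurable (hmp.map_eq.symm ▸ hind.aestronglyMeasurable),
    integral_congr_ae hsplit, hmp.map_eq,
    integral_prod _ ((hmp.integrable_comp_of_integrable hind).congr hsplit)]
  refine integral_congr_ae (ae_of_all _ fun x => ?_)
  by_cases hxA : x ∈ A
  · simp only [Set.indicator_of_mem hxA]
  · simp only [Set.indicator_of_notMem hxA, integral_zero]

variable [MeasurableConstSMul G X]

theorem setIntegral_comp_eq_zero_of_mem_measurableCylinders (hβ : IsBoundaryMap μ β) {f : X → ℝ}
    (hf : Measurable f) (hf_int : Integrable f (harmonicMeasure μ β))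
    (hzero : ∀ n g, posLaw μ n {g} ≠ 0 → ∫ b, f b ∂(harmonicMeasure μ β).map (g • ·) = 0)
    {A : Set (ℕ → G)} (hA : A ∈ measurableCylinders fun _ : ℕ => G) :
    ∫ x in A, f (β x) ∂walk μ = 0 := by
  have hA_meas : MeasurableSet A := .of_mem_measurableCylinders hA
  obtain ⟨s, S, -, rfl⟩ := (mem_measurableCylinders A).1 hA
  obtain ⟨n, hn⟩ : ∃ n, ∀ i ∈ s, i < n :=
    ⟨s.sup id + 1, fun i hi => Nat.lt_succ_of_le (Finset.le_sup (f := id) hi)⟩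
  have hconcat (p : (ℕ → G) × (ℕ → G)) : concat n p ∈ cylinder s S ↔ p.1 ∈ cylinder s S := by
    have : s.restrict (concat n p) = s.restrict p.1 :=
      funext fun i => concat_of_lt (hn i i.2) p
    rw [mem_cylinder, mem_cylinder, this]
  rw [hβ.setIntegral_comp_eq_setIntegral_integral_smul hf_int hA_meas hconcat]
  refine integral_eq_zero_of_ae (ae_restrict_of_ae ?_)
  filter_upwards [ae_posLaw_ne_zero μ n] with x hx
  rw [← hβ.integral_map_smul_harmonicMeasure hf, hzero n _ hx, Pi.zero_apply]

theorem ae_eq_zero_of_forall_integral_map_smul_eq_zero (hβ : IsBoundaryMap μ β) {f : X → ℝ}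
    (hf : Measurable f) (hf_int : Integrable f (harmonicMeasure μ β))
    (hzero : ∀ n g, posLaw μ n {g} ≠ 0 → ∫ b, f b ∂(harmonicMeasure μ β).map (g • ·) = 0) :
    f =ᵐ[harmonicMeasure μ β] 0 := by
  have h : (fun x => f (β x)) =ᵐ[walk μ] 0 :=
    ae_eq_zero_of_forall_setIntegral_isPiSystem_eq_zero (hf_int.comp_measurable hβ.measurable)
      generateFrom_measurableCylinders.symm isPiSystem_measurableCylinders
      (univ_mem_measurableCylinders _)
      fun _ => hβ.setIntegral_comp_eq_zero_of_mem_measurableCylinders hf hf_int hzero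
  exact (ae_map_iff hβ.measurable.aemeasurable (measurableSet_eq_fun hf measurable_zero)).2 h

variable [StandardBorelSpace X]
  {Y : Type*} [mY : MeasurableSpace Y] [MeasurableEq Y] [MulAction G Y] {q : X → Y}

theorem isIsoModZero_of_translateDensity_ae_eq_comp (hβ : IsBoundaryMap μ β) (hq : Measurable q)
    (h : ∀ n g, posLaw μ n {g} ≠ 0 →
      translateDensity (harmonicMeasure μ β) g =ᵐ[harmonicMeasure μ β]
        fun b => translateDensity (harmonicMeasure μ (q ∘ β)) g (q b)) :
    IsIsoModZero q (harmonicMeasure μ β) ((harmonicMeasure μ β).map q) := by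
  have := hβ.isProbabilityMeasure_harmonicMeasure
  have := sigmaFinite_map_smul (G := G) (harmonicMeasure μ β)
  have := nonempty_of_isProbabilityMeasure (harmonicMeasure μ β)
  set ν := harmonicMeasure μ β
  obtain ⟨e, he, c, hc⟩ := exists_bounded_measurableEmbedding_real X
  have he_int : Integrable e ν :=
    .of_bound he.measurable.aestronglyMeasurable c (ae_of_all _ hc)
  have hm : mY.comap q ≤ _ := hq.comap_le
  have hE : StronglyMeasurable[mY.comap q] (ν[e|mY.comap q]) := stronglyMeasurable_condExp
  have heE : (fun b => e b - (ν[e|mY.comap q]) b) =ᵐ[ν] 0 := by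
    refine hβ.ae_eq_zero_of_forall_integral_map_smul_eq_zero
      (he.measurable.sub (hE.mono hm).measurable) (he_int.sub integrable_condExp) fun n g hg => ?_
    let w : X → ℝ := fun b => (translateDensity (harmonicMeasure μ (q ∘ β)) g (q b)).toReal
    have hw : StronglyMeasurable[mY.comap q] w :=
      ((measurable_translateDensity _ g).ennreal_toReal.comp
        (comap_measurable q)).stronglyMeasurable
    have hDw : (fun b => (translateDensity ν g b).toReal) =ᵐ[ν] w :=
      (h n g hg).mono fun b => congrArg ENNReal.toReal
    have hw_int : Integrable w ν := Measure.integrable_toReal_rnDeriv.congr hDw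
    rw [← integral_rnDeriv_smul (hβ.map_smul_absolutelyContinuous hg),
      ← integral_smul_sub_condExp_eq_zero hm hw he_int
        (hw_int.mul_bdd (c := c) he.measurable.aestronglyMeasurable (ae_of_all _ hc))]
    exact integral_congr_ae (hDw.mono fun b hb => congrArg (· • _) hb)
  obtain ⟨k, hk, hkq⟩ := hE.measurable.exists_eq_measurable_comp
  refine isIsoModZero_of_ae_eq_comp hq he hk (heE.mono fun b hb => ?_)
  rw [hkq] at hb
  exact sub_eq_zero.1 hb

theorem isIsoModZero_of_gauge [MeasurableConstSMul G Y] (hβ : IsBoundaryMap μ β)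
    (hμ : FiniteEntropy μ) (hq : IsMuBoundary μ β q) {𝒢 : Y → ℕ → Gauge G}
    (h𝒢 : ∀ᵐ b ∂(harmonicMeasure μ β).map q, UniformlyTemperate (𝒢 b))
    (hlim : ∀ᵐ x ∂walk μ,
      Tendsto (fun n : ℕ => 1 / (n : ℝ) * ((𝒢 (q (β x)) n).norm (x n) : ℝ)) atTop (𝓝 0)) :
    IsIsoModZero q (harmonicMeasure μ β) ((harmonicMeasure μ β).map q) := by
  have hqβ := hq.isBoundaryMap_comp hβ
  rw [← hβ.harmonicMeasure_comp hq.measurable] at h𝒢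
  have hlog := hβ.logDensity_one_ae_eq_comp hμ hq.measurable hqβ
    (hβ.integral_logDensity_one_le_of_gauge hμ hqβ h𝒢 hlim)
  exact hβ.isIsoModZero_of_translateDensity_ae_eq_comp hq.measurable fun n g hg =>
    hβ.translateDensity_ae_eq_comp hq.measurable hqβ (hβ.logDensity_ae_eq_comp hqβ hlog n) hg

end IsBoundaryMap

end Maximality

end RandomWalk

open RandomWalk in
theorem theorem5p5_general {G : Type*} [Group G] [Countable G] [MeasurableSpace G]
    [MeasurableSingletonClass G] (μ : Measure G) [IsProbabilityMeasure μ] (hμ : FiniteEntropy μ)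
    {X : Type*} [MeasurableSpace X] [StandardBorelSpace X] [MulAction G X]
    [MeasurableConstSMul G X] (β : (ℕ → G) → X) (hβ : IsBoundaryMap μ β)
    {B : Type*} [MeasurableSpace B] [MeasurableEq B] [MulAction G B]
    [MeasurableConstSMul G B] (quot : X → B) (hquot : IsMuBoundary μ β quot) :
    (∀ 𝒢 : B → ℕ → Gauge G,
      (∀ᵐ b ∂((harmonicMeasure μ β).map quot), UniformlyTemperate (𝒢 b)) →
      (∀ᵐ x ∂(walk μ), Tendsto (fun n : ℕ => 1 / (n : ℝ) * ((𝒢 (quot (β x)) n).norm (x n) : ℝ))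
        atTop (𝓝 0)) →
      IsIsoModZero quot (harmonicMeasure μ β) ((harmonicMeasure μ β).map quot)) ∧
    (∀ 𝒢 : Gauge G, 𝒢.Temperate →
      ∀ π : ℕ → B → G,
      (∀ᵐ x ∂(walk μ), Tendsto
        (fun n : ℕ => 1 / (n : ℝ) * (𝒢.norm ((π n (quot (β x)))⁻¹ * x n) : ℝ)) atTop (𝓝 0)) →
      IsIsoModZero quot (harmonicMeasure μ β) ((harmonicMeasure μ β).map quot)) := by
  refine ⟨fun 𝒢 => hβ.isIsoModZero_of_gauge hμ hquot, fun 𝒢 h𝒢 π hlim => ?_⟩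
  exact hβ.isIsoModZero_of_gauge hμ hquot (𝒢 := fun b n => 𝒢.translate (π n b))
    (ae_of_all _ fun b => h𝒢.uniformlyTemperate_translate fun n => π n b)
    (by simpa only [Gauge.norm_translate] using hlim)

open RandomWalk in
theorem theorem5p5 {G : Type*} [Group G] [Countable G] [MeasurableSpace G]
    [MeasurableSingletonClass G] (μ : Measure G) [IsProbabilityMeasure μ] (hμ : FiniteEntropy μ)
    {Γ : Type*} [MeasurableSpace Γ] [StandardBorelSpace Γ] [MulAction G Γ]
    [MeasurableConstSMul G Γ] (bnd : (ℕ → G) → Γ) (hbnd : IsPoissonBoundary μ bnd)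
    {B : Type*} [MeasurableSpace B] [StandardBorelSpace B] [MulAction G B]
    [MeasurableConstSMul G B] (quot : Γ → B) (hquot : IsMuBoundary μ bnd quot) :
    (∀ 𝒢 : B → ℕ → Gauge G,
      (∀ᵐ b ∂((harmonicMeasure μ bnd).map quot), UniformlyTemperate (𝒢 b)) →
      (∀ᵐ x ∂(walk μ), Tendsto (fun n : ℕ => 1 / (n : ℝ) * ((𝒢 (quot (bnd x)) n).norm (x n) : ℝ))
        atTop (𝓝 0)) →
      IsIsoModZero quot (harmonicMeasure μ bnd) ((harmonicMeasure μ bnd).map quot)) ∧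
    (∀ 𝒢 : Gauge G, 𝒢.Temperate →
      ∀ π : ℕ → B → G, (∀ n, Measurable (π n)) →
      (∀ᵐ x ∂(walk μ), Tendsto
        (fun n : ℕ => 1 / (n : ℝ) * (𝒢.norm ((π n (quot (bnd x)))⁻¹ * x n) : ℝ)) atTop (𝓝 0)) →
      IsIsoModZero quot (harmonicMeasure μ bnd) ((harmonicMeasure μ bnd).map quot)) :=
  have h := theorem5p5_general μ hμ bnd hbnd.isBoundaryMap quot hquot
  ⟨h.1, fun 𝒢 h𝒢 π _ => h.2 𝒢 h𝒢 π⟩
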